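/- **Theorem (Liveness of Highway).** Setting. There is a finite set $\mathcal V$ of $n$ validators with synchronized clocks. Blocks form a tree rooted at the genesis block $G$; $B\le B'$ means that $B'$ is a descendant of $B$ or $B'=B$, and the height of a block is its distance from $G$. A unit $u$ has a sender $S(u)$, a finite list of cited units and possibly a block; $v\le u$ means that $v$ is reached from $u$ along citations, $D(u)=\{v: v<u\}$ and $\bar D(u)=D(u)\cup\{u\}$. A validator equivocates in a set of units if the set contains two $\le$-incomparable units sent by it. The vote of $u$ is defined recursively: the opinion of a validator $V$ at $u$ is the vote of the latest unit of $V$ in $D(u)$ if there is such a unit and $V$ does not equivocate in $D(u)$, and $G$ otherwise; $\mathrm{vote}(u)$ is the leaf reached from $G$ in the tree of blocks carried by units of $\bar D(u)$ by always moving to the child that has the largest number of validators whose opinion is a descendant of this child (ties are broken by an injective hash). Finality. A $(q,k)$-summit for $B$ relative to a set of units $\sigma$ is a sequence of non-empty sets $\sigma\supseteq C_0\supseteq C_1\supseteq\dots\supseteq C_k$ such that $\mathrm{vote}(u)\ge B$ for $u\in C_0$; no sender of a unit of $C_0$ equivocates in $\sigma$; $u_0,u_2\in C_i$, $u_0\le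 u_1\le u_2$ and $S(u_0)=S(u_1)=S(u_2)$ imply $u_1\in C_i$; and for $i<k$ and $u\in C_{i+1}$ the units of $\bar D(u)\cap C_i$ whose senders have a unit in $C_{i+1}$ have at least $q$ different senders. A validator has $B$ finalized with confidence $t$ (an integer) at some time if its local DAG $\sigma$ at this time has a $(q,k)$-summit for $B$ with $(2q-n)(1-2^{-k})>t$. Network and protocol. $f$ validators are Byzantine (arbitrary behaviour, but they cannot forge units of others); $c$ of the others crash at some time; the remaining ones are called honest here. A unit is received along with its downset. Every unit sent by a non-Byzantine validator eventually reaches every non-Byzantine validator, and takes less than $\Delta$ if it is sent after an unknown time GST. Rounds $r=0,1,2,\dots$ have length $R=3\Delta$ and a leader $\mathrm{LEADER}(r)$. In each round, with times measured from its start, every non-Byzantine validator that has not crashed does the following. At time $0$ the leader moves all units of its buffer to its local DAG and creates a proposal unit $u_L$ with a new block $B$ such that $\mathrm{vote}(u_L)=B$. In $[0,R/3)$, when a non-leader first receives a new unit of the leader, it adds it with its downset to its local DAG and at once creates a confirmation unit; all other units that arrive in this slot are buffered. At time $R/3$ the buffer is moved to the local DAG, and units that arrive in $[R/3,2R/3)$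 are added right away. At time $2R/3$ the validator creates a witness unit; units that arrive in $[2R/3,R)$ are buffered. Every created unit is broadcast, has exactly the creator's local DAG as its downset, and is added to this local DAG right away. These are the only units that non-Byzantine validators create, and only proposal units among them carry a block. Claim. Let $t$ be an integer with $0\le t<\frac n3$, and assume that $f\le t$, that $c<\frac{n-3t}2$, and that $\mathrm{LEADER}(r)$ is honest (neither Byzantine nor crashing) for infinitely many $r$. Then the chain of blocks finalized with confidence $t$ grows indefinitely for each honest validator $V$: there is an infinite chain $G=B_0,B_1,B_2,\dots$ in which $B_h$ is the parent of $B_{h+1}$, such that every block that $V$ ever has finalized with confidence $t$ is one of the $B_h$, and for every $h$ the block $B_h$ is finalized with confidence $t$ by $V$ at all sufficiently late times. -/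

import Mathlib

open Filter

namespace Highway

/-- Blocks. The reference to the parent (a hash) is modelled by the parent itself, so that the
block graph is a tree rooted at the genesis block. -/
inductive Block (α : Type*) where
  | genesis : Block α
  | child (parent : Block α) (content : α) : Block α

namespace Block

variable {α : Type*}

/-- The height of a block. -/
def height : Block α → ℕ
  | genesis => 0
  | child P _ => height P + 1

/-- `Anc A B`: the block `B` is a descendant of `A` (possibly `A` itself), written `A ≤ B`. -/
inductive Anc : Block α → Block α → Prop where
  | refl (A : Block α) : Anc A A
  | step {A P : Block α} (a : α) : Anc A P → Anc A (child P a)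

/-- `IsChild P B`: the parent of `B` is `P`, that is, `B ∈ next(P)`. -/
def IsChild (P B : Block α) : Prop := ∃ a : α, B = child P a

end Block

/-- Units: a sender, a list of citations and possibly a block. As for blocks, a hash is modelled
by the object that it refers to. -/
structure HUnit (V α : Type*) where
  sender : V
  citations : List (HUnit V α)
  block : Option (Block α)

namespace HUnit

variable {V α : Type*}

/-- The (strict) downset `D(u)`: all units that can be reached from `u` by a nonempty chain of
citations. -/
def down (u : HUnit V α) : Set (HUnit V α) :=
  {v | Relation.TransGen (fun x y : HUnit V α => x ∈ y.citations) v u}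

/-- The downset of `u` together with `u` itself. -/
def downC (u : HUnit V α) : Set (HUnit V α) := insert u u.down

/-- The justification order `v ≤ u`. -/
def Le (v u : HUnit V α) : Prop := v ∈ u.downC

theorem sizeOf_lt_of_mem_citations {u v : HUnit V α} (h : v ∈ u.citations) :
    sizeOf v < sizeOf u := by
  cases u with
  | mk s c b =>
    have h1 := List.sizeOf_lt_of_mem h
    simp only [HUnit.mk.sizeOf_spec] at *
    omega

theorem sizeOf_lt_of_mem_down {u v : HUnit V α} (h : v ∈ u.down) : sizeOf v < sizeOf u := by
  have h1 : Relation.TransGen (fun x y : HUnit V α => x ∈ y.citations) v u := h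
  clear h
  induction h1 with
  | single h => exact sizeOf_lt_of_mem_citations h
  | tail h0 h ih => exact lt_trans ih (sizeOf_lt_of_mem_citations h)

/-- The validators that have created two incomparable units of the set `S`. -/
def equivocators (S : Set (HUnit V α)) : Set V :=
  {p | ∃ u ∈ S, ∃ v ∈ S, u.sender = p ∧ v.sender = p ∧ ¬ Le u v ∧ ¬ Le v u}

/-- The set `L(u)` of the latest units below `u` of the validators that do not equivocate
below `u`. -/
def latest (u : HUnit V α) : Set (HUnit V α) :=
  {v | v ∈ u.down ∧ v.sender ∉ equivocators u.down ∧
    ∀ w ∈ u.down, v ∈ w.down → w.sender ≠ v.sender}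

/-- All blocks that are carried by a unit of `S`, and the genesis block. -/
def blocks (S : Set (HUnit V α)) : Set (Block α) :=
  insert Block.genesis {B | ∃ u ∈ S, u.block = some B}

end HUnit

section Ghost

variable {V α κ : Type*} [LinearOrder κ]

/-- The number of validators whose opinion is a descendant of `B`. -/
noncomputable def total (opinion : V → Block α) (B : Block α) : ℕ :=
  {p : V | Block.Anc B (opinion p)}.ncard

/-- `B'` is the child of `B` in the set of blocks `S` that has the largest total; ties are broken
by the hash. -/
def IsBestChild (hash : Block α → κ) (S : Set (Block α)) (opinion : V → Block α)
    (B B' : Block α) : Prop :=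
  B' ∈ S ∧ Block.IsChild B B' ∧ ∀ B'' ∈ S, Block.IsChild B B'' →
    total opinion B'' < total opinion B' ∨
      (total opinion B'' = total opinion B' ∧ hash B'' ≤ hash B')

open Classical in
/-- One step of the descent: go to the best child, or stay in place at a leaf. -/
noncomputable def ghostStep (hash : Block α → κ) (S : Set (Block α)) (opinion : V → Block α)
    (B : Block α) : Block α :=
  if h : ∃ B', IsBestChild hash S opinion B B' then h.choose else B

/-- The GHOST rule: descend from the genesis block until a leaf is reached. In a finite set `S`
that contains the genesis block the descent ends after fewer than `S.ncard` steps. -/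
noncomputable def ghost (hash : Block α → κ) (S : Set (Block α)) (opinion : V → Block α) :
    Block α :=
  (ghostStep hash S opinion)^[S.ncard] Block.genesis

open Classical in
/-- The virtual vote of a unit: the GHOST rule for the blocks in the closed downset of `u`, where
the opinion of a validator is the vote of its latest unit below `u` if there is one, and the
genesis block otherwise. -/
noncomputable def vote (hash : Block α → κ) (u : HUnit V α) : Block α :=
  ghost hash (HUnit.blocks u.downC) fun p =>
    if h : ∃ v, v ∈ u.latest ∧ v.sender = p then vote hash h.choose else Block.genesis
termination_by sizeOf u
decreasing_by exact HUnit.sizeOf_lt_of_mem_down h.choose_spec.1.1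

/-- A `(q, k)`-summit `(C 0, …, C k)` for the block `B` relative to the state `σ`. -/
structure IsSummit (hash : Block α → κ) (B : Block α) (σ : Set (HUnit V α)) (q k : ℕ)
    (C : ℕ → Set (HUnit V α)) : Prop where
  subset_state : C 0 ⊆ σ
  nested : ∀ i < k, C (i + 1) ⊆ C i
  nonempty : (C k).Nonempty
  unanimity : ∀ u ∈ C 0, Block.Anc B (vote hash u)
  honesty : ∀ u ∈ C 0, u.sender ∉ HUnit.equivocators σ
  convexity : ∀ i ≤ k, ∀ u₀ ∈ C i, ∀ u₂ ∈ C i, ∀ u₁ : HUnit V α, u₀.Le u₁ → u₁.Le u₂ →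
    u₀.sender = u₁.sender → u₁.sender = u₂.sender → u₁ ∈ C i
  density : ∀ i < k, ∀ u ∈ C (i + 1),
    q ≤ (HUnit.sender ''
      (u.downC ∩ {v | v ∈ C i ∧ ∃ w ∈ C (i + 1), v.sender = w.sender})).ncard

/-- `FINAL(B, σ, t) = 1`. -/
def Final [Fintype V] (hash : Block α → κ) (B : Block α) (σ : Set (HUnit V α)) (t : ℕ) : Prop :=
  ∃ (q k : ℕ) (C : ℕ → Set (HUnit V α)), IsSummit hash B σ q k C ∧
    (t : ℝ) < (2 * (q : ℝ) - (Fintype.card V : ℝ)) * (1 - ((2 : ℝ) ^ k)⁻¹)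

end Ghost

/-- The data of an execution. Times are real numbers measured on the synchronized clocks, the
value `⊤` means never. -/
structure Execution (V α : Type*) where
  /-- the delay bound -/
  Δ : ℝ
  /-- the Global Stabilization Time -/
  gst : ℝ
  /-- the leader schedule -/
  leader : ℕ → V
  /-- the Byzantine validators -/
  byzantine : Set V
  /-- the time at which a validator crashes -/
  crash : V → WithTop ℝ
  /-- the time at which the sender of a unit creates and broadcasts it, if this sender is not
  Byzantine (not used for Byzantine senders) -/
  creation : HUnit V α → WithTop ℝ
  /-- the time at which a validator receives a unit for the first time, be it directly or as a
  part of the downset of another unit; its own units count as received on creation -/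
  arrival : V → HUnit V α → WithTop ℝ

namespace Execution

variable {V α κ : Type*} [LinearOrder κ]

/-- The validators that crash at some time without being Byzantine. -/
def crashing (E : Execution V α) : Set V := {p | p ∉ E.byzantine ∧ E.crash p ≠ ⊤}

/-- Neither Byzantine nor crashing. -/
def Correct (E : Execution V α) (p : V) : Prop := p ∉ E.byzantine ∧ E.crash p = ⊤

/-- The length `R` of a round. -/
def roundLength (E : Execution V α) : ℝ := 3 * E.Δ

/-- The time at which round `r` starts. -/
def start (E : Execution V α) (r : ℕ) : ℝ := r * E.roundLength

/-- The units that `p` has received (or created) strictly before time `s`. -/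
def received (E : Execution V α) (p : V) (s : ℝ) : Set (HUnit V α) :=
  {u | E.arrival p u < (s : WithTop ℝ)}

/-- The units that `p` has created up to time `s`. -/
def own (E : Execution V α) (p : V) (s : ℝ) : Set (HUnit V α) :=
  {u | u.sender = p ∧ E.creation u ≤ (s : WithTop ℝ)}

/-- The local DAG of `p` during the last third of round `r - 1` (empty for `r = 0`), which is
still its local DAG at the start of round `r`, before any action of round `r`. The units that `p`
receives in this last third are in the buffer. -/
def carried (E : Execution V α) (p : V) (r : ℕ) : Set (HUnit V α) :=
  E.received p (E.start r - E.Δ) ∪ E.own p (E.start r - E.Δ)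

/-- `u` is the proposal unit of `p` in round `r`: the leader moves its buffer to its local DAG at
the start of the round and creates a unit above it with a new block, for which the unit votes. -/
def IsProposal (hash : Block α → κ) (E : Execution V α) (p : V) (r : ℕ) (u : HUnit V α) : Prop :=
  u.sender = p ∧ E.leader r = p ∧ E.creation u = (E.start r : WithTop ℝ) ∧
    u.down = E.received p (E.start r) ∧
    ∃ B, u.block = some B ∧ B ∉ HUnit.blocks u.down ∧ vote hash u = B

/-- `x` is a first unit of the leader of round `r` that `p` receives in the first third of this
round. -/
def IsTrigger (E : Execution V α) (p : V) (r : ℕ) (x : HUnit V α) : Prop :=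
  x.sender = E.leader r ∧ (E.start r : WithTop ℝ) ≤ E.arrival p x ∧
    E.arrival p x < ((E.start r + E.Δ : ℝ) : WithTop ℝ) ∧
    ∀ y : HUnit V α, y.sender = E.leader r → (E.start r : WithTop ℝ) ≤ E.arrival p y →
      E.arrival p x ≤ E.arrival p y

/-- `u` is the confirmation unit of `p` in round `r`: when a non-leader receives a new unit `x` of
the leader in the first third of the round, it adds `x` with its downset to its local DAG, whose
other units are still those from the start of the round, and at once creates a unit above this. -/
def IsConfirmation (E : Execution V α) (p : V) (r : ℕ) (u : HUnit V α) : Prop :=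
  u.sender = p ∧ E.leader r ≠ p ∧ u.block = none ∧
    ∃ x, E.IsTrigger p r x ∧ E.creation u = E.arrival p x ∧ u.down = E.carried p r ∪ x.downC

/-- `u` is the witness unit of `p` in round `r`, created after two thirds of the round above all
units that `p` has received or created before. (The buffer has been emptied after one third, and
units received in the second third have been added right away.) -/
def IsWitness (E : Execution V α) (p : V) (r : ℕ) (u : HUnit V α) : Prop :=
  u.sender = p ∧ u.block = none ∧ E.creation u = ((E.start r + 2 * E.Δ : ℝ) : WithTop ℝ) ∧
    u.down = E.received p (E.start r + 2 * E.Δ)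

/-- `E` is an execution of the protocol in the partially synchronous model: Byzantine validators
are unconstrained, all others follow the unit creation and reception strategy until they crash. -/
structure IsRun (hash : Block α → κ) (E : Execution V α) : Prop where
  Δ_pos : 0 < E.Δ
  /-- the execution starts at time `0` -/
  arrival_nonneg : ∀ p ∉ E.byzantine, ∀ u, 0 ≤ E.arrival p u
  /-- a unit is received along with its downset -/
  arrival_mono : ∀ p ∉ E.byzantine, ∀ u, ∀ v ∈ u.citations, E.arrival p v ≤ E.arrival p u
  /-- signatures cannot be forged: a unit of a validator that is not Byzantine is received only
  after this validator has created it -/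
  creation_le_arrival : ∀ p ∉ E.byzantine, ∀ u : HUnit V α, u.sender ∉ E.byzantine →
    E.creation u ≤ E.arrival p u
  /-- a validator adds its own units right away -/
  arrival_own : ∀ u : HUnit V α, u.sender ∉ E.byzantine → E.arrival u.sender u = E.creation u
  /-- reliable channels -/
  arrival_lt_top : ∀ p ∉ E.byzantine, ∀ u : HUnit V α, u.sender ∉ E.byzantine →
    E.creation u < ⊤ → E.arrival p u < ⊤
  /-- a unit that is sent at a time `s` after the Global Stabilization Time takes less than `Δ` -/
  arrival_lt : ∀ p ∉ E.byzantine, ∀ u : HUnit V α, u.sender ∉ E.byzantine →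
    ∀ s : ℝ, E.creation u = (s : WithTop ℝ) → E.gst ≤ s →
      E.arrival p u < ((s + E.Δ : ℝ) : WithTop ℝ)
  /-- no unit is created at or after the crash -/
  creation_lt_crash : ∀ u : HUnit V α, u.sender ∉ E.byzantine → E.creation u < ⊤ →
    E.creation u < E.crash u.sender
  /-- only the units that the strategy prescribes are created -/
  creation_role : ∀ u : HUnit V α, u.sender ∉ E.byzantine → E.creation u < ⊤ →
    ∃ r, E.IsProposal hash u.sender r u ∨ E.IsConfirmation u.sender r u ∨ E.IsWitness u.sender r u
  /-- the leader of a round creates one proposal unit, at the start of the round -/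
  proposal : ∀ p ∉ E.byzantine, ∀ r, E.leader r = p → (E.start r : WithTop ℝ) < E.crash p →
    ∃! u, E.IsProposal hash p r u
  /-- a non-leader that receives a new unit of the leader in the first third of the round creates
  one confirmation unit -/
  confirmation : ∀ p ∉ E.byzantine, ∀ r, E.leader r ≠ p →
    (∃ x, E.IsTrigger p r x ∧ E.arrival p x < E.crash p) → ∃! u, E.IsConfirmation p r u
  /-- every validator creates one witness unit in every round -/
  witness : ∀ p ∉ E.byzantine, ∀ r, ((E.start r + 2 * E.Δ : ℝ) : WithTop ℝ) < E.crash p →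
    ∃! u, E.IsWitness p r u

open Classical in
/-- The protocol state (local DAG) of `p` at time `s`, after the actions that take place at this
very time.

In the first third of a round the leader has what it had received before the round and its
proposal unit; all others have the units carried over from the round before and, as soon as they
have created a confirmation unit, this unit with its downset. In the second third all received
units are in the local DAG. In the last third the newly received units stay in the buffer. -/
noncomputable def state (E : Execution V α) (p : V) (s : ℝ) : Set (HUnit V α) :=
  let r : ℕ := ⌊s / E.roundLength⌋₊
  if s < E.start r + E.Δ then
    if E.leader r = p then E.received p (E.start r) ∪ E.own p s
    else E.carried p r ∪
      {v | ∃ u, E.IsConfirmation p r u ∧ E.creation u ≤ (s : WithTop ℝ) ∧ v ∈ u.downC}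
  else if s < E.start r + 2 * E.Δ then {u | E.arrival p u ≤ (s : WithTop ℝ)}
  else E.received p (E.start r + 2 * E.Δ) ∪ E.own p s

/-- At time `s` the validator `p` has the block `B` finalized for the confidence threshold `t`. -/
def Finalized [Fintype V] (hash : Block α → κ) (E : Execution V α) (t : ℕ) (p : V) (s : ℝ)
    (B : Block α) : Prop :=
  Final hash B (E.state p s) t

end Execution

end Highway

/-!
**Why liveness holds.**

*A correct leader fixes the votes.* Consider a round after the Global Stabilization Time whose
leader is correct. The witness units of the round before reach the leader in time, so that the
proposal unit `u` is above everything that a confirming validator had in its local DAG; the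
confirmation units have exactly the closed downset of `u` as their downset
(`IsRun.confirmation_down_eq`). The only opinion that differs from those at `u` is the one of the
leader, which is now the vote of `u`, so that the confirmation units vote for the new block as
well (`anc_vote_of_down_eq`). All units of correct validators after these are above such a unit of
every correct validator, and the correct validators are a majority, so by induction they vote for
the new block (`IsRun.locked_of_proposal`). The next correct leader puts a new block on top of it,
whence such blocks have unbounded heights (`IsRun.exists_locked`).

*Fixed votes lead to finality.* Witness units reach everyone by the end of the round, and the
units of correct validators two rounds later are above all of them. The units of correct
validators from every other round on are the levels of a summit of any given height, in which the
correct validators are a quorum of size `q` with `2 * q - n > t`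
(`IsRun.eventually_finalized_of_locked`).

*Finality is safe.* Finalized blocks do not conflict, hence lie on one chain. A unit above level
`i + 1` of a `(q, k)`-summit sees `q` validators at level `i`. If it is a first such unit not to
vote for the block, then enough of these `q` validators equivocate visibly or have changed their
mind, and are thus exposed as equivocators when compared with the summit. Combined with the
deviators needed for the first change of mind, this gives by induction at least
`(2 * q - n) * (1 - 2⁻¹ ^ i)` equivocators (`IsSummit.le_ncard_deviators`), more than the Byzantine
validators, as the units of the others form chains (`IsRun.le_of_creation_le`).
-/

namespace Highway

/-! ### Blocks -/

namespace Block

variable {α : Type*}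

theorem Anc.trans {A B C : Block α} (h₁ : Anc A B) (h₂ : Anc B C) : Anc A C := by
  induction h₂ with
  | refl => exact h₁
  | step a _ ih => exact .step a ih

theorem anc_child_iff {A P : Block α} {a : α} :
    Anc A (child P a) ↔ A = child P a ∨ Anc A P := by
  constructor
  · intro h
    cases h with
    | refl => exact .inl rfl
    | step _ h => exact .inr h
  · rintro (rfl | h)
    · exact .refl _
    · exact .step a h

theorem anc_genesis_iff {A : Block α} : Anc A genesis ↔ A = genesis := by
  constructor
  · intro h
    cases h
    rfl
  · rintro rfl
    exact .refl _

theorem parent_anc (P : Block α) (a : α) : Anc P (child P a) := .step a (.refl P)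

theorem Anc.height_le {A B : Block α} (h : Anc A B) : A.height ≤ B.height := by
  induction h with
  | refl => exact le_rfl
  | step a _ ih => exact ih.trans (Nat.le_succ _)

theorem Anc.eq_of_height_le {A B : Block α} (h : Anc A B) (hh : B.height ≤ A.height) :
    A = B := by
  cases h with
  | refl => rfl
  | step a h =>
    have := h.height_le
    simp only [height] at hh
    omega

theorem Anc.comparable {A B C : Block α} (hA : Anc A C) (hB : Anc B C) :
    Anc A B ∨ Anc B A := by
  induction C with
  | genesis =>
    rw [anc_genesis_iff] at hA hB
    exact .inl (hA ▸ hB ▸ .refl _)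
  | child P a ih =>
    rcases anc_child_iff.1 hA with rfl | hA'
    · exact .inr hB
    · rcases anc_child_iff.1 hB with rfl | hB'
      · exact .inl hA
      · exact ih hA' hB'

theorem Anc.eq_of_height_eq {A B C : Block α} (hA : Anc A C) (hB : Anc B C)
    (h : A.height = B.height) : A = B := by
  rcases hA.comparable hB with h' | h'
  · exact h'.eq_of_height_le h.ge
  · exact (h'.eq_of_height_le h.le).symm

theorem exists_anc_height_eq (B : Block α) {h : ℕ} (hB : h ≤ B.height) :
    ∃ A, Anc A B ∧ A.height = h := by
  induction B with
  | genesis => exact ⟨genesis, .refl _, (Nat.le_zero.1 hB).symm⟩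
  | child P a ih =>
    rcases hB.eq_or_lt with rfl | hlt
    · exact ⟨_, .refl _, rfl⟩
    · obtain ⟨A, hA, hh⟩ := ih (Nat.lt_succ_iff.1 hlt)
      exact ⟨A, .step a hA, hh⟩

theorem height_eq_zero_iff {B : Block α} : B.height = 0 ↔ B = genesis := by
  cases B <;> simp [height]

theorem Anc.isChild {A B : Block α} (h : Anc A B) (hh : B.height = A.height + 1) :
    IsChild A B := by
  cases h with
  | refl => omega
  | step a h =>
    obtain rfl := h.eq_of_height_le (by simpa [height] using hh.le)
    exact ⟨a, rfl⟩

end Block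

/-! ### The GHOST rule -/

section Ghost

open Block

variable {V α κ : Type*} [LinearOrder κ] {hash : Block α → κ} {S : Set (Block α)}
  {op : V → Block α}

theorem total_le_total [Finite V] {op' : V → Block α} {A A' : Block α}
    (h : ∀ p, Anc A (op p) → Anc A' (op' p)) : total op A ≤ total op' A' :=
  Set.ncard_le_ncard h (Set.toFinite _)

theorem IsBestChild.unique (hinj : Function.Injective hash) {B B' B'' : Block α}
    (h' : IsBestChild hash S op B B') (h'' : IsBestChild hash S op B B'') : B' = B'' := by
  rcases h'.2.2 B'' h''.1 h''.2.1 with h1 | ⟨h1, h2⟩ <;>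
    rcases h''.2.2 B' h'.1 h'.2.1 with h3 | ⟨h3, h4⟩
  · omega
  · omega
  · omega
  · exact hinj (le_antisymm h4 h2)

theorem IsBestChild.ghostStep_eq (hinj : Function.Injective hash) {B B' : Block α}
    (h : IsBestChild hash S op B B') : ghostStep hash S op B = B' := by
  have hex : ∃ B', IsBestChild hash S op B B' := ⟨B', h⟩
  rw [ghostStep, dif_pos hex]
  exact hex.choose_spec.unique hinj h

theorem ghostStep_eq_or_isBestChild (B : Block α) :
    ghostStep hash S op B = B ∨ IsBestChild hash S op B (ghostStep hash S op B) := by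
  rw [ghostStep]
  split_ifs with h
  · exact .inr h.choose_spec
  · exact .inl rfl

theorem anc_ghostStep (B : Block α) : Anc B (ghostStep hash S op B) := by
  rcases ghostStep_eq_or_isBestChild (hash := hash) (S := S) (op := op) B with h | ⟨-, ⟨a, h⟩, -⟩
  · rw [h]
    exact .refl _
  · rw [h]
    exact parent_anc B a

theorem anc_iterate_ghostStep (m : ℕ) (B : Block α) : Anc B ((ghostStep hash S op)^[m] B) := by
  induction m with
  | zero => exact .refl _
  | succ m ih =>
    rw [Function.iterate_succ_apply']
    exact ih.trans (anc_ghostStep _)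

theorem isBestChild_of_anc_ghost {P : Block α} {a : α}
    (h : Anc (child P a) (ghost hash S op)) : IsBestChild hash S op P (child P a) := by
  unfold ghost at h
  generalize S.ncard = m at h
  induction m with
  | zero => exact absurd (anc_genesis_iff.1 h) (by simp)
  | succ m ih =>
    rw [Function.iterate_succ_apply'] at h
    rcases ghostStep_eq_or_isBestChild (hash := hash) (S := S) (op := op)
      ((ghostStep hash S op)^[m] genesis) with h' | h'
    · exact ih (h' ▸ h)
    · obtain ⟨b, hb⟩ := h'.2.1
      rw [hb] at h h'
      rcases anc_child_iff.1 h with h1 | h1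
      · obtain ⟨rfl, rfl⟩ := Block.child.inj h1
        exact h'
      · exact ih h1

/-- A block to which best children lead from the genesis block is an ancestor of the outcome of
the GHOST rule: `S.ncard` steps suffice to reach it, as the path consists of elements of `S`. -/
theorem anc_ghost (hinj : Function.Injective hash) (hS : S.Finite) {B : Block α}
    (hbest : ∀ P a, Anc (child P a) B → IsBestChild hash S op P (child P a)) :
    Anc B (ghost hash S op) := by
  have hpath : ∀ A, Anc A B → (ghostStep hash S op)^[A.height] genesis = A := by
    intro A
    induction A with
    | genesis => exact fun _ => rfl
    | child P a ih =>
      intro hA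
      rw [height, Function.iterate_succ_apply', ih ((parent_anc P a).trans hA)]
      exact (hbest P a hA).ghostStep_eq hinj
  have hcard : B.height ≤ S.ncard := by
    have hsub : Set.Icc 1 B.height ⊆ height '' S := by
      rintro h ⟨h1, h2⟩
      obtain ⟨A, hA, rfl⟩ := exists_anc_height_eq B h2
      cases A with
      | genesis => exact absurd h1 (by simp [height])
      | child P a => exact ⟨_, (hbest P a hA).1, rfl⟩
    calc B.height = (Set.Icc 1 B.height).ncard := by
          rw [← Finset.coe_Icc, Set.ncard_coe_finset, Nat.card_Icc]; omega
      _ ≤ (height '' S).ncard := Set.ncard_le_ncard hsub (hS.image _)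
      _ ≤ S.ncard := Set.ncard_image_le hS
  obtain ⟨m, hm⟩ := Nat.exists_eq_add_of_le' hcard
  rw [ghost, hm, Function.iterate_add_apply, hpath B (.refl B)]
  exact anc_iterate_ghostStep m B

/-- If more opinions support `B` than conflict with it, then the GHOST rule leads to `B`. -/
theorem anc_ghost_of_majority [Finite V] (hinj : Function.Injective hash) (hS : S.Finite)
    {B : Block α} (hB : ∀ A, Anc A B → A ∈ S)
    (hmaj : {p | op p ≠ genesis ∧ ¬ Anc B (op p)}.ncard < {p | Anc B (op p)}.ncard) :
    Anc B (ghost hash S op) := by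
  refine anc_ghost hinj hS fun P a hA => ⟨hB _ hA, ⟨a, rfl⟩, ?_⟩
  rintro _ - ⟨b, rfl⟩
  by_cases hab : b = a
  · exact .inr ⟨by rw [hab], by rw [hab]⟩
  · left
    calc total op (child P b) ≤ {p | op p ≠ genesis ∧ ¬ Anc B (op p)}.ncard := by
          refine Set.ncard_le_ncard (fun p hp => ⟨fun h => ?_, fun h => hab ?_⟩) (Set.toFinite _)
          · have hp' : Anc (child P b) (op p) := hp
            rw [h, anc_genesis_iff] at hp'
            exact absurd hp' (by simp)
          · exact (Block.child.inj (Anc.eq_of_height_eq hp (hA.trans h) rfl)).2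
      _ < {p | Anc B (op p)}.ncard := hmaj
      _ ≤ total op (child P a) :=
          Set.ncard_le_ncard (fun p hp => hA.trans hp) (Set.toFinite _)

/-- The outcome of the GHOST rule keeps its support if some opinions are changed to this
outcome. -/
theorem anc_ghost_of_change [Finite V] (hinj : Function.Injective hash) (hS : S.Finite)
    {op' : V → Block α}
    (h : ∀ p, op' p = op p ∨ op' p = ghost hash S op) :
    Anc (ghost hash S op) (ghost hash S op') := by
  refine anc_ghost hinj hS fun P a hA => ?_
  have hbest := isBestChild_of_anc_ghost hA
  refine ⟨hbest.1, hbest.2.1, ?_⟩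
  rintro _ hS ⟨b, rfl⟩
  by_cases hab : b = a
  · exact .inr ⟨by rw [hab], by rw [hab]⟩
  · have h1 : total op (child P a) ≤ total op' (child P a) :=
      total_le_total fun p hp => by
        rcases h p with h | h <;> rw [h]
        exacts [hp, hA]
    have h2 : total op' (child P b) ≤ total op (child P b) :=
      total_le_total fun p hp => by
        rcases h p with h | h <;> rw [h] at hp
        · exact hp
        · exact absurd (Block.child.inj (hp.eq_of_height_eq hA rfl)).2 hab
    rcases hbest.2.2 _ hS ⟨b, rfl⟩ with h3 | ⟨h3, h4⟩
    · left
      omega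
    · rcases (h2.trans (h3.le.trans h1)).lt_or_eq with h5 | h5
      · exact .inl h5
      · exact .inr ⟨h5, h4⟩

end Ghost

/-! ### Units, latest units and votes -/

namespace HUnit

variable {V α : Type*}

theorem mem_down_trans {u v w : HUnit V α} (h₁ : w ∈ v.down) (h₂ : v ∈ u.down) : w ∈ u.down :=
  Relation.TransGen.trans h₁ h₂

theorem Le.refl (u : HUnit V α) : Le u u := .inl rfl

theorem downC_subset_down {u v : HUnit V α} (h : v ∈ u.down) : v.downC ⊆ u.down := by
  rintro w (rfl | hw)
  · exact h
  · exact mem_down_trans hw h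

theorem down_subset_of_le {u v : HUnit V α} (h : Le v u) : v.down ⊆ u.down := by
  rcases h with rfl | h
  · exact subset_rfl
  · exact fun w hw => mem_down_trans hw h

theorem Le.trans {u v w : HUnit V α} (h₁ : Le w v) (h₂ : Le v u) : Le w u := by
  rcases h₁ with rfl | h₁
  · exact h₂
  · exact .inr (down_subset_of_le h₂ h₁)

theorem down_finite (u : HUnit V α) : u.down.Finite := by
  induction h : sizeOf u using Nat.strong_induction_on generalizing u with
  | _ m ih =>
    subst h
    have hsub : u.down ⊆ ⋃ v ∈ {v | v ∈ u.citations}, v.downC := by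
      intro w hw
      obtain ⟨v, h1, h2⟩ := Relation.TransGen.tail'_iff.1 hw
      refine Set.mem_biUnion h2 ?_
      exact (Relation.reflTransGen_iff_eq_or_transGen.1 h1).imp Eq.symm id
    refine Set.Finite.subset ?_ hsub
    refine (List.finite_toSet u.citations).biUnion fun v hv => ?_
    exact (ih _ (sizeOf_lt_of_mem_citations hv) v rfl).insert v

theorem downC_finite (u : HUnit V α) : u.downC.Finite := u.down_finite.insert u

theorem equivocators_mono {S T : Set (HUnit V α)} (h : S ⊆ T) :
    equivocators S ⊆ equivocators T := by
  rintro p ⟨u, hu, v, hv, h'⟩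
  exact ⟨u, h hu, v, h hv, h'⟩

theorem blocks_mono {S T : Set (HUnit V α)} (h : S ⊆ T) : blocks S ⊆ blocks T := by
  rintro B (rfl | ⟨u, hu, hB⟩)
  · exact .inl rfl
  · exact .inr ⟨u, h hu, hB⟩

theorem blocks_finite {S : Set (HUnit V α)} (hS : S.Finite) : (blocks S).Finite := by
  refine ((hS.image fun u => u.block.getD Block.genesis).subset ?_).insert _
  rintro B ⟨u, hu, hB⟩
  exact ⟨u, hu, by simp [hB]⟩

theorem exists_latest {u z : HUnit V α} (hz : z ∈ u.down)
    (hne : z.sender ∉ equivocators u.down) :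
    ∃ v ∈ u.latest, v.sender = z.sender ∧ Le z v := by
  obtain ⟨v, ⟨hv1, hv2, hv3⟩, hmax⟩ :=
    Set.exists_max_image {v | v ∈ u.down ∧ v.sender = z.sender ∧ Le z v} sizeOf
      (u.down_finite.subset fun v hv => hv.1) ⟨z, hz, rfl, .refl z⟩
  refine ⟨v, ⟨hv1, hv2 ▸ hne, fun w hw hvw hs => ?_⟩, hv2, hv3⟩
  have h1 := hmax w ⟨hw, hs.trans hv2, hv3.trans (.inr hvw)⟩
  have h2 := sizeOf_lt_of_mem_down hvw
  omega

theorem eq_of_mem_latest {u v w : HUnit V α} (hv : v ∈ u.latest) (hw : w ∈ u.latest)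
    (h : v.sender = w.sender) : v = w := by
  by_contra hne
  refine hv.2.1 ⟨v, hv.1, w, hw.1, rfl, h.symm, ?_, ?_⟩
  · rintro (h' | h')
    · exact hne h'
    · exact hv.2.2 w hw.1 h' h.symm
  · rintro (h' | h')
    · exact hne h'.symm
    · exact hw.2.2 v hv.1 h' h

end HUnit

section Vote

open HUnit Block

variable {V α κ : Type*} [LinearOrder κ] {hash : Block α → κ}

open Classical in
/-- The opinion of the validator `p` at the unit `u`, to which `vote` applies the GHOST rule. -/
noncomputable def opinion (hash : Block α → κ) (u : HUnit V α) (p : V) : Block α :=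
  if h : ∃ v, v ∈ u.latest ∧ v.sender = p then vote hash h.choose else Block.genesis

theorem vote_eq_ghost (hash : Block α → κ) (u : HUnit V α) :
    vote hash u = ghost hash (blocks u.downC) (opinion hash u) := by
  rw [vote]
  rfl

theorem opinion_eq_vote {u v : HUnit V α} (hv : v ∈ u.latest) :
    opinion hash u v.sender = vote hash v := by
  have h : ∃ w, w ∈ u.latest ∧ w.sender = v.sender := ⟨v, hv, rfl⟩
  rw [opinion, dif_pos h, eq_of_mem_latest h.choose_spec.1 hv h.choose_spec.2]

theorem opinion_eq_genesis {u : HUnit V α} {p : V} (h : ∀ v ∈ u.latest, v.sender ≠ p) :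
    opinion hash u p = genesis :=
  dif_neg fun ⟨v, hv, hp⟩ => h v hv hp

theorem opinion_eq_genesis_of_mem_equivocators {u : HUnit V α} {p : V}
    (h : p ∈ equivocators u.down) : opinion hash u p = genesis :=
  opinion_eq_genesis fun _ hv hp => hv.2.1 (hp ▸ h)

theorem mem_blocks_of_anc_vote {u : HUnit V α} {B : Block α} (h : Anc B (vote hash u)) :
    B ∈ blocks u.downC := by
  cases B with
  | genesis => exact .inl rfl
  | child P a =>
    rw [vote_eq_ghost] at h
    exact (isBestChild_of_anc_ghost h).1

theorem anc_vote_of_majority [Finite V] (hinj : Function.Injective hash) {u : HUnit V α}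
    {B : Block α}
    (hmaj : {p | opinion hash u p ≠ genesis ∧ ¬ Anc B (opinion hash u p)}.ncard
      < {p | Anc B (opinion hash u p)}.ncard) : Anc B (vote hash u) := by
  rw [vote_eq_ghost]
  refine anc_ghost_of_majority hinj (blocks_finite u.downC_finite) (fun A hA => ?_) hmaj
  obtain ⟨p, hp⟩ := Set.nonempty_of_ncard_ne_zero (Nat.ne_zero_of_lt hmaj)
  replace hp : Anc A (opinion hash u p) := hA.trans hp
  by_cases h : ∃ v ∈ u.latest, v.sender = p
  · obtain ⟨v, hv, rfl⟩ := h
    rw [opinion_eq_vote hv] at hp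
    exact blocks_mono ((downC_subset_down hv.1).trans (Set.subset_insert _ _))
      (mem_blocks_of_anc_vote hp)
  · rw [opinion_eq_genesis (by simpa using h), anc_genesis_iff] at hp
    exact .inl hp

/-- A unit without a block that has exactly the closed downset of `u` as its downset supports the
vote of `u`: the only validator that may have a new opinion is the sender of `u`, which now has
the vote of `u`. -/
theorem anc_vote_of_down_eq [Finite V] (hinj : Function.Injective hash) {u c : HUnit V α}
    (hdown : c.down = u.downC) (hblock : c.block = none)
    (hne : u.sender ∉ equivocators u.downC) : Anc (vote hash u) (vote hash c) := by
  have hu : u ∉ u.down := fun h => (sizeOf_lt_of_mem_down h).false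
  have hblocks : blocks c.downC = blocks u.downC := by
    refine Set.Subset.antisymm ?_ (blocks_mono (hdown ▸ Set.subset_insert _ _))
    rintro B (rfl | ⟨v, rfl | hv, hB⟩)
    · exact .inl rfl
    · simp [hblock] at hB
    · exact .inr ⟨v, hdown ▸ hv, hB⟩
  have hlatest : ∀ v : HUnit V α, v.sender ≠ u.sender → (v ∈ c.latest ↔ v ∈ u.latest) := by
    intro v hs
    have h1 : v ∈ u.downC ↔ v ∈ u.down := by
      refine ⟨?_, .inr⟩
      rintro (rfl | h)
      exacts [absurd rfl hs, h]
    have h2 : v.sender ∈ equivocators u.downC ↔ v.sender ∈ equivocators u.down := by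
      refine ⟨?_, fun h => equivocators_mono (Set.subset_insert _ _) h⟩
      rintro ⟨x, rfl | hx, y, rfl | hy, h3, h4, h5⟩
      · exact absurd h3.symm hs
      · exact absurd h3.symm hs
      · exact absurd h4.symm hs
      · exact ⟨x, hx, y, hy, h3, h4, h5⟩
    have h3 : (∀ w ∈ u.downC, v ∈ w.down → w.sender ≠ v.sender) ↔
        ∀ w ∈ u.down, v ∈ w.down → w.sender ≠ v.sender := by
      refine ⟨fun h w hw => h w (.inr hw), ?_⟩
      rintro h w (rfl | hw)
      · exact fun _ => hs.symm
      · exact h w hw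
    simp only [latest, Set.mem_ofPred_eq, hdown, h1, h2, h3]
  rw [vote_eq_ghost hash c, hblocks, vote_eq_ghost hash u]
  refine anc_ghost_of_change hinj (blocks_finite u.downC_finite) fun p => ?_
  rw [← vote_eq_ghost]
  by_cases hp : p = u.sender
  · right
    rw [hp]
    refine opinion_eq_vote ⟨hdown ▸ .inl rfl, hdown ▸ hne, fun w hw huw => ?_⟩
    rw [hdown] at hw
    rcases hw with rfl | hw
    · exact absurd huw hu
    · exact absurd (mem_down_trans huw hw) hu
  · left
    by_cases h : ∃ v ∈ u.latest, v.sender = p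
    · obtain ⟨v, hv, rfl⟩ := h
      rw [opinion_eq_vote hv, opinion_eq_vote ((hlatest v hp).2 hv)]
    · rw [opinion_eq_genesis fun v hv hs => h ⟨v, hv, hs⟩,
        opinion_eq_genesis fun v hv hs => h ⟨v, (hlatest v (hs ▸ hp)).1 hv, hs⟩]

end Vote

/-! ### Safety of summits -/

section Safety

open HUnit Block

variable {V α κ : Type*} [LinearOrder κ] {hash : Block α → κ}

/-- The validators that equivocate below `u`, or have a unit below `u` that is incomparable with
all of their units in some level `C j` with `j ≤ i` (to which they contribute). The units of
`C j` need not be below `u`. -/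
def deviators (C : ℕ → Set (HUnit V α)) (i : ℕ) (u : HUnit V α) : Set V :=
  equivocators u.down ∪ {p | ∃ x ∈ u.down, x.sender = p ∧ ∃ j ≤ i,
    (∃ y ∈ C j, y.sender = p) ∧ ∀ y ∈ C j, y.sender = p → ¬ Le x y ∧ ¬ Le y x}

theorem deviators_mono {C : ℕ → Set (HUnit V α)} {i j : ℕ} (hij : i ≤ j) {u v : HUnit V α}
    (h : v ∈ u.down) : deviators C i v ⊆ deviators C j u := by
  have hsub : v.down ⊆ u.down := down_subset_of_le (.inr h)
  rintro p (hp | ⟨x, hx, hs, l, hl, hC⟩)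
  · exact .inl (equivocators_mono hsub hp)
  · exact .inr ⟨x, hsub hx, hs, l, hl.trans hij, hC⟩

theorem IsSummit.antitone {B : Block α} {σ : Set (HUnit V α)} {q k : ℕ}
    {C : ℕ → Set (HUnit V α)} (h : IsSummit hash B σ q k C) {i j : ℕ} (hij : i ≤ j)
    (hj : j ≤ k) : C j ⊆ C i := by
  induction j, hij using Nat.le_induction with
  | base => exact subset_rfl
  | succ j hij ih => exact (h.nested j hj).trans (ih (Nat.le_of_succ_le hj))

theorem IsSummit.deviators_subset {B : Block α} {σ : Set (HUnit V α)} {q k : ℕ}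
    {C : ℕ → Set (HUnit V α)} (h : IsSummit hash B σ q k C) (u : HUnit V α) :
    deviators C k u ⊆ equivocators (u.down ∪ σ) := by
  rintro p (hp | ⟨x, hx, hs, j, hj, ⟨y, hy, hyp⟩, hC⟩)
  · exact equivocators_mono Set.subset_union_left hp
  · exact ⟨x, .inl hx, y, .inr (h.subset_state (h.antitone (Nat.zero_le j) hj hy)), hs, hyp,
      hC y hy hyp⟩

/-- The counting step: `Q` are `q` validators seen to belong to a level of a summit, `D` are those
seen to equivocate, `F` and `A` are the supporters and opponents at a unit, `W` are the members
of `Q` that changed their mind, and `X` is a set of deviators of the preceding level. -/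
theorem two_mul_ncard_add_le [Fintype V] {Q D F A W X X' : Set V}
    (hFA : F.ncard ≤ A.ncard) (hQ : Q ⊆ F ∪ W ∪ Q ∩ D) (hAD : Disjoint A D) (hAQ : A ∩ Q ⊆ W)
    (hWQ : W ⊆ Q \ D) (hXQ : Disjoint (X \ D) Q) (hX' : D ∪ W ∪ X ⊆ X') :
    2 * Q.ncard + X.ncard ≤ Fintype.card V + 2 * X'.ncard := by
  have hfin : ∀ S : Set V, S.Finite := fun S => S.toFinite
  have h1 : Q.ncard ≤ F.ncard + W.ncard + (Q ∩ D).ncard :=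
    (Set.ncard_le_ncard hQ (hfin _)).trans <| (Set.ncard_union_le _ _).trans <|
      Nat.add_le_add_right (Set.ncard_union_le _ _) _
  have h2 : A.ncard ≤ (A \ Q).ncard + W.ncard := by
    have := Set.ncard_inter_add_ncard_sdiff_eq_ncard A Q
    have := Set.ncard_le_ncard hAQ (hfin _)
    omega
  have h3 : (A \ Q).ncard + Q.ncard + (D \ Q).ncard ≤ Fintype.card V := by
    rw [← Set.ncard_union_eq Set.disjoint_sdiff_left (hfin _) (hfin _),
      ← Set.ncard_union_eq _ (hfin _) (hfin _), ← Nat.card_eq_fintype_card, ← Set.ncard_univ]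
    · exact Set.ncard_le_ncard (Set.subset_univ _) (hfin _)
    · refine Set.disjoint_union_left.2 ⟨?_, Set.disjoint_sdiff_right⟩
      exact hAD.mono Set.sdiff_subset Set.sdiff_subset
  have h4 : (Q ∩ D).ncard + (D \ Q).ncard = D.ncard := by
    rw [Set.inter_comm, Set.ncard_inter_add_ncard_sdiff_eq_ncard D Q]
  have h5 : X.ncard ≤ (X \ D).ncard + D.ncard := by
    have := Set.ncard_inter_add_ncard_sdiff_eq_ncard X D
    have := Set.ncard_le_ncard (Set.inter_subset_right : X ∩ D ⊆ D) (hfin _)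
    omega
  have h6 : D.ncard + W.ncard + (X \ D).ncard ≤ X'.ncard := by
    rw [← Set.ncard_union_eq _ (hfin _) (hfin _), ← Set.ncard_union_eq _ (hfin _) (hfin _)]
    · refine Set.ncard_le_ncard (subset_trans ?_ hX') (hfin _)
      exact Set.union_subset_union_right _ Set.sdiff_subset
    · refine Set.disjoint_union_left.2 ⟨Set.disjoint_sdiff_right, ?_⟩
      exact hXQ.symm.mono_left (hWQ.trans Set.sdiff_subset)
    · exact Set.disjoint_sdiff_right.mono_right hWQ
  omega

/-- A unit above a unit of level `i` of a summit for `B` that does not vote for `B` reveals many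
deviators. The number of deviators needed approaches `2 * q - n` geometrically: at the first
such unit above level `i + 1`, a majority for `B` can be lost only through equivocators and
validators that changed their mind above level `i`, and the first of the latter already required
the bound for `i`. -/
theorem IsSummit.le_ncard_deviators [Fintype V] (hinj : Function.Injective hash) {B : Block α}
    {σ : Set (HUnit V α)} {q k : ℕ} {C : ℕ → Set (HUnit V α)} (h : IsSummit hash B σ q k C)
    {i : ℕ} (hi : i ≤ k) {u y : HUnit V α} (hy : y ∈ C i) (hyu : Le y u)
    (hu : ¬ Anc B (vote hash u)) :
    (2 * (q : ℝ) - Fintype.card V) * (1 - ((2 : ℝ) ^ i)⁻¹) ≤ (deviators C i u).ncard := by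
  induction i generalizing u y with
  | zero => simp
  | succ i ihi =>
    induction hm : sizeOf u using Nat.strong_induction_on generalizing u y with
    | _ m ihu =>
    subst hm
    by_cases hex : ∃ v ∈ u.down, (∃ z ∈ C (i + 1), Le z v) ∧ ¬ Anc B (vote hash v)
    · obtain ⟨v, hv, ⟨z, hz, hzv⟩, hvB⟩ := hex
      refine (ihu _ (sizeOf_lt_of_mem_down hv) hz hzv hvB rfl).trans ?_
      exact_mod_cast Set.ncard_le_ncard (deviators_mono le_rfl hv) (Set.toFinite _)
    have hmin : ∀ v ∈ u.down, ∀ z ∈ C (i + 1), Le z v → Anc B (vote hash v) := by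
      intro v hv z hz hzv
      by_contra hvB
      exact hex ⟨v, hv, ⟨z, hz, hzv⟩, hvB⟩
    have hyd : y ∈ u.down := by
      rcases hyu with rfl | hyu
      · exact absurd (h.unanimity _ (h.antitone (Nat.zero_le _) hi hy)) hu
      · exact hyu
    set Q : Set V := HUnit.sender ''
      (y.downC ∩ {v | v ∈ C i ∧ ∃ w ∈ C (i + 1), v.sender = w.sender}) with hQdef
    have hQ : ∀ p ∈ Q, ∃ z ∈ u.down, z ∈ C i ∧ z.sender = p ∧
        ∃ w ∈ C (i + 1), w.sender = p := by
      rintro _ ⟨z, ⟨hz, hzC, w, hw, hzw⟩, rfl⟩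
      exact ⟨z, downC_subset_down hyd hz, hzC, rfl, w, hw, hzw.symm⟩
    have hqQ : q ≤ Q.ncard := h.density i hi y hy
    set D : Set V := equivocators u.down
    set W : Set V := {p | p ∈ Q ∧ p ∉ D ∧ ¬ Anc B (opinion hash u p)}
    have hW : ∀ p ∈ W, p ∈ deviators C (i + 1) u ∧
        ∃ v ∈ u.down, (∃ z ∈ C i, Le z v) ∧ ¬ Anc B (vote hash v) := by
      rintro p ⟨hpQ, hpD, hpB⟩
      obtain ⟨z, hz, hzC, rfl, w, hw, hws⟩ := hQ p hpQ
      obtain ⟨v, hv, hvs, hzv⟩ := exists_latest hz hpD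
      rw [← hvs, opinion_eq_vote hv] at hpB
      refine ⟨.inr ⟨v, hv.1, hvs, i + 1, le_rfl, ⟨w, hw, hws⟩, fun x hx hxs => ⟨?_, ?_⟩⟩,
        v, hv.1, ⟨z, hzC, hzv⟩, hpB⟩
      · -- By convexity, a unit between two units of `C i` votes for `B`.
        intro hvx
        refine hpB (h.unanimity v (h.antitone (Nat.zero_le i) (Nat.le_of_succ_le hi) ?_))
        exact h.convexity i (Nat.le_of_succ_le hi) z hzC x (h.nested i hi hx) v hzv hvx hvs.symm
          (hvs.trans hxs.symm)
      · exact fun hxv => hpB (hmin v hv.1 x hx hxv)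
    have hcount : ∀ X X' : Set V, D ∪ W ∪ X ⊆ X' → Disjoint (X \ D) Q →
        2 * q + X.ncard ≤ Fintype.card V + 2 * X'.ncard := by
      intro X X' hX' hXQ
      refine le_trans (by omega) (two_mul_ncard_add_le (Q := Q) (D := D) (W := W)
        (F := {p | Anc B (opinion hash u p)})
        (A := {p | opinion hash u p ≠ genesis ∧ ¬ Anc B (opinion hash u p)})
        ?_ ?_ ?_ ?_ ?_ hXQ hX')
      · by_contra hlt
        exact hu (anc_vote_of_majority hinj (not_le.1 hlt))
      · intro p hp
        by_cases h1 : p ∈ D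
        · exact .inr ⟨hp, h1⟩
        · by_cases h2 : Anc B (opinion hash u p)
          · exact .inl (.inl h2)
          · exact .inl (.inr ⟨hp, h1, h2⟩)
      · exact Set.disjoint_left.2 fun p hp hpD =>
          hp.1 (opinion_eq_genesis_of_mem_equivocators hpD)
      · exact fun p hp => ⟨hp.2, fun hpD => hp.1.1 (opinion_eq_genesis_of_mem_equivocators hpD),
          hp.1.2⟩
      · exact fun p hp => ⟨hp.1, hp.2.1⟩
    rcases W.eq_empty_or_nonempty with hWe | ⟨p, hp⟩
    · -- Nobody changed their mind, so that the equivocators below `u` suffice.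
      have hD := hcount D D (by simp [hWe]) (by simp)
      have hD' : D.ncard ≤ (deviators C (i + 1) u).ncard :=
        Set.ncard_le_ncard Set.subset_union_left (Set.toFinite _)
      have ha : 2 * (q : ℝ) ≤ Fintype.card V + (deviators C (i + 1) u).ncard := by
        exact_mod_cast (by omega : 2 * q ≤ Fintype.card V + (deviators C (i + 1) u).ncard)
      have h0 : (0 : ℝ) ≤ (deviators C (i + 1) u).ncard := Nat.cast_nonneg _
      have h1 : (0 : ℝ) < ((2 : ℝ) ^ (i + 1))⁻¹ := by positivity
      have h2 : ((2 : ℝ) ^ (i + 1))⁻¹ ≤ 1 := inv_le_one_of_one_le₀ (one_le_pow₀ (by norm_num))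
      refine (mul_le_mul_of_nonneg_right (by linarith : _ ≤ ((deviators C (i + 1) u).ncard : ℝ))
        (by linarith)).trans (mul_le_of_le_one_right h0 (by linarith))
    · obtain ⟨-, v, hv, ⟨z, hz, hzv⟩, hvB⟩ := hW p hp
      have hX := hcount (deviators C i v) (deviators C (i + 1) u)
        (Set.union_subset (Set.union_subset Set.subset_union_left fun p hp => (hW p hp).1)
          (deviators_mono (Nat.le_succ i) hv)) <| by
        refine Set.disjoint_left.2 fun p ⟨hpX, hpD⟩ hpQ => hpD ?_
        rcases hpX with hpX | ⟨x, hx, hxs, j, hj, -, hC⟩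
        · exact equivocators_mono (down_subset_of_le (.inr hv)) hpX
        · obtain ⟨y', hy', hyC, hys, -⟩ := hQ p hpQ
          exact ⟨x, down_subset_of_le (.inr hv) hx, y', hy', hxs, hys,
            hC y' (h.antitone hj (Nat.le_of_succ_le hi) hyC) hys⟩
      have hih := ihi (Nat.le_of_succ_le hi) hz hzv hvB
      have hX' : 2 * (q : ℝ) + (deviators C i v).ncard
          ≤ Fintype.card V + 2 * (deviators C (i + 1) u).ncard := by exact_mod_cast hX
      have hpow : ((2 : ℝ) ^ (i + 1))⁻¹ = ((2 : ℝ) ^ i)⁻¹ / 2 := by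
        rw [pow_succ, mul_inv, div_eq_mul_inv]
      rw [hpow]
      linarith

/-- All units above the last level of a summit vote for its block, also those outside of the state
of the summit, as long as at most `t` validators equivocate overall. -/
theorem IsSummit.anc_vote [Fintype V] (hinj : Function.Injective hash) {B : Block α}
    {σ U : Set (HUnit V α)} {q k t : ℕ} {C : ℕ → Set (HUnit V α)} (h : IsSummit hash B σ q k C)
    (hqk : (t : ℝ) < (2 * (q : ℝ) - Fintype.card V) * (1 - ((2 : ℝ) ^ k)⁻¹))
    (hσ : σ ⊆ U) (ht : (equivocators U).ncard ≤ t) {u y : HUnit V α} (hu : u.down ⊆ U)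
    (hy : y ∈ C k) (hyu : Le y u) : Anc B (vote hash u) := by
  by_contra huB
  have h1 := h.le_ncard_deviators hinj le_rfl hy hyu huB
  have h2 : (deviators C k u).ncard ≤ t :=
    (Set.ncard_le_ncard ((h.deviators_subset u).trans
      (equivocators_mono (Set.union_subset hu hσ))) (Set.toFinite _)).trans ht
  have h3 : ((deviators C k u).ncard : ℝ) ≤ t := by exact_mod_cast h2
  linarith

/-- The senders of the last level of a summit are a quorum. -/
theorem IsSummit.lt_ncard_senders [Fintype V] {B : Block α} {σ : Set (HUnit V α)} {q k t : ℕ}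
    {C : ℕ → Set (HUnit V α)} (h : IsSummit hash B σ q k C)
    (hqk : (t : ℝ) < (2 * (q : ℝ) - Fintype.card V) * (1 - ((2 : ℝ) ^ k)⁻¹)) :
    Fintype.card V + t < 2 * (HUnit.sender '' C k).ncard := by
  have ht : (0 : ℝ) ≤ t := Nat.cast_nonneg t
  cases k with
  | zero =>
    simp only [pow_zero, inv_one, sub_self, mul_zero] at hqk
    linarith
  | succ k =>
    obtain ⟨u, hu⟩ := h.nonempty
    have hq : q ≤ (HUnit.sender '' C (k + 1)).ncard := by
      refine (h.density k (Nat.lt_succ_self k) u hu).trans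
        (Set.ncard_le_ncard ?_ (Set.toFinite _))
      rintro _ ⟨v, ⟨-, -, w, hw, hvw⟩, rfl⟩
      exact ⟨w, hw, hvw.symm⟩
    have h1 : (0 : ℝ) < ((2 : ℝ) ^ (k + 1))⁻¹ := by positivity
    have h2 : ((2 : ℝ) ^ (k + 1))⁻¹ ≤ 1 := inv_le_one_of_one_le₀ (one_le_pow₀ (by norm_num))
    have h3 : (t : ℝ) < 2 * (q : ℝ) - Fintype.card V := by
      by_contra! hle
      nlinarith
    have h4 : Fintype.card V + t < 2 * q := by
      have : (Fintype.card V : ℝ) + t < 2 * q := by linarith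
      exact_mod_cast this
    omega

/-- Blocks that are finalized in two states do not conflict if at most `t` validators equivocate:
some validator without equivocations contributes to the last levels of both summits, and the
later one of two of its units there votes for both blocks. -/
theorem Final.comparable [Fintype V] (hinj : Function.Injective hash) {B B' : Block α}
    {σ σ' U : Set (HUnit V α)} {t : ℕ} (h : Final hash B σ t) (h' : Final hash B' σ' t)
    (hσ : σ ⊆ U) (hσ' : σ' ⊆ U) (hU : ∀ u ∈ U, u.down ⊆ U) (ht : (equivocators U).ncard ≤ t) :
    Anc B B' ∨ Anc B' B := by
  obtain ⟨q, k, C, hC, hqk⟩ := h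
  obtain ⟨q', k', C', hC', hqk'⟩ := h'
  have h1 := hC.lt_ncard_senders hqk
  have h2 := hC'.lt_ncard_senders hqk'
  have h3 := Set.ncard_union_add_ncard_inter (HUnit.sender '' C k) (HUnit.sender '' C' k')
    (Set.toFinite _) (Set.toFinite _)
  have h4 : (HUnit.sender '' C k ∪ HUnit.sender '' C' k').ncard ≤ Fintype.card V := by
    rw [← Nat.card_eq_fintype_card, ← Set.ncard_univ]
    exact Set.ncard_le_ncard (Set.subset_univ _) (Set.toFinite _)
  obtain ⟨p, ⟨⟨y, hy, hyp⟩, y', hy', hyp'⟩, hp⟩ := Set.exists_mem_notMem_of_ncard_lt_ncard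
    (show (equivocators U).ncard < (HUnit.sender '' C k ∩ HUnit.sender '' C' k').ncard by omega)
    (Set.toFinite _)
  have hyU : y ∈ U := hσ (hC.subset_state (hC.antitone (Nat.zero_le k) le_rfl hy))
  have hyU' : y' ∈ U := hσ' (hC'.subset_state (hC'.antitone (Nat.zero_le k') le_rfl hy'))
  have hle : Le y y' ∨ Le y' y := by
    by_contra! hne
    exact hp ⟨y, hyU, y', hyU', hyp, hyp', hne⟩
  rcases hle with hle | hle
  · exact (hC.anc_vote hinj hqk hσ ht (hU _ hyU') hy hle).comparable
      (hC'.anc_vote hinj hqk' hσ' ht (hU _ hyU') hy' (.refl _))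
  · exact (hC.anc_vote hinj hqk hσ ht (hU _ hyU) hy (.refl _)).comparable
      (hC'.anc_vote hinj hqk' hσ' ht (hU _ hyU) hy' hle)

theorem Final.of_anc [Fintype V] {A B : Block α} {σ : Set (HUnit V α)} {t : ℕ}
    (hA : Anc A B) (h : Final hash B σ t) : Final hash A σ t := by
  obtain ⟨q, k, C, hC, hqk⟩ := h
  exact ⟨q, k, C, { hC with unanimity := fun u hu => hA.trans (hC.unanimity u hu) }, hqk⟩

end Safety

/-! ### Units of an execution -/

namespace Execution

open HUnit Block

variable {V α κ : Type*} [LinearOrder κ] {hash : Block α → κ} {E : Execution V α}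

theorem start_succ (E : Execution V α) (r : ℕ) : E.start (r + 1) = E.start r + 3 * E.Δ := by
  simp only [start, roundLength]
  push_cast
  ring

/-- The units that `p` receives at some time. -/
def arrived (E : Execution V α) (p : V) : Set (HUnit V α) := {u | E.arrival p u < ⊤}

theorem received_mono {p : V} {s s' : ℝ} (h : s ≤ s') : E.received p s ⊆ E.received p s' :=
  fun u hu => lt_of_lt_of_le (show E.arrival p u < _ from hu) (WithTop.coe_le_coe.2 h)

theorem received_subset_arrived (p : V) (s : ℝ) : E.received p s ⊆ E.arrived p :=
  fun u hu => lt_of_lt_of_le (show E.arrival p u < _ from hu) le_top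

namespace IsRun

variable (hE : E.IsRun hash)
include hE

theorem start_mono {a b : ℕ} (h : a ≤ b) : E.start a ≤ E.start b := by
  have hΔ := hE.Δ_pos
  unfold start roundLength
  gcongr

theorem start_lt_imp {a b : ℕ} (h : E.start a < E.start b + 3 * E.Δ) : a ≤ b := by
  by_contra! hlt
  have := hE.start_mono (Nat.succ_le_of_lt hlt)
  rw [start_succ] at this
  linarith

theorem round_unique {a b : ℕ} {c : ℝ} (ha : E.start a ≤ c) (ha' : c ≤ E.start a + 2 * E.Δ)
    (hb : E.start b ≤ c) (hb' : c ≤ E.start b + 2 * E.Δ) : a = b := by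
  have hΔ := hE.Δ_pos
  exact le_antisymm (hE.start_lt_imp (by linarith)) (hE.start_lt_imp (by linarith))

theorem arrival_le_of_le {p : V} (hp : p ∉ E.byzantine) {u v : HUnit V α} (h : Le v u) :
    E.arrival p v ≤ E.arrival p u := by
  rcases h with rfl | h
  · exact le_rfl
  · replace h : Relation.TransGen (fun x y : HUnit V α => x ∈ y.citations) v u := h
    induction h with
    | single h => exact hE.arrival_mono p hp _ _ h
    | tail _ h ih => exact ih.trans (hE.arrival_mono p hp _ _ h)

theorem down_subset_arrived {p : V} (hp : p ∉ E.byzantine) {u : HUnit V α}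
    (hu : u ∈ E.arrived p) : u.down ⊆ E.arrived p :=
  fun _ hv => (hE.arrival_le_of_le hp (.inr hv)).trans_lt hu

theorem mem_received_of_le {p : V} (hp : p ∉ E.byzantine) {u v : HUnit V α} {s : ℝ}
    (hu : u ∈ E.received p s) (h : Le v u) : v ∈ E.received p s :=
  (hE.arrival_le_of_le hp h).trans_lt hu

/-- A unit of a non-Byzantine validator belongs to a round, and its role in this round determines
its creation time. -/
theorem exists_round {u : HUnit V α} (hu : u.sender ∉ E.byzantine) (hc : E.creation u < ⊤) :
    ∃ (r : ℕ) (c : ℝ), E.creation u = c ∧ E.start r ≤ c ∧ c ≤ E.start r + 2 * E.Δ ∧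
      ((E.IsProposal hash u.sender r u ∧ c = E.start r) ∨
        (E.IsConfirmation u.sender r u ∧ c < E.start r + E.Δ) ∨
        (E.IsWitness u.sender r u ∧ c = E.start r + 2 * E.Δ)) := by
  have hΔ := hE.Δ_pos
  obtain ⟨r, h | h | h⟩ := hE.creation_role u hu hc
  · exact ⟨r, _, h.2.2.1, le_rfl, by linarith, .inl ⟨h, rfl⟩⟩
  · obtain ⟨x, ⟨-, h1, h2, -⟩, hx, -⟩ := h.2.2.2
    rw [← hx] at h1 h2
    obtain ⟨c, hc⟩ := WithTop.ne_top_iff_exists.1 hc.ne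
    rw [← hc] at h1 h2
    have h1' : E.start r ≤ c := by exact_mod_cast h1
    have h2' : c < E.start r + E.Δ := by exact_mod_cast h2
    exact ⟨r, c, hc.symm, h1', by linarith, .inr (.inl ⟨h, h2'⟩)⟩
  · exact ⟨r, _, h.2.2.1, by linarith, le_rfl, .inr (.inr ⟨h, rfl⟩)⟩

theorem creation_lt_crash' {u : HUnit V α} {p : V} (hu : u.sender = p) (hp : p ∉ E.byzantine)
    {c : ℝ} (hc : E.creation u = c) : (c : WithTop ℝ) < E.crash p := by
  subst hu
  exact hc ▸ hE.creation_lt_crash u hp (hc ▸ WithTop.coe_lt_top c)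

theorem proposal_unique {p : V} (hp : p ∉ E.byzantine) {r : ℕ} {u v : HUnit V α}
    (hu : E.IsProposal hash p r u) (hv : E.IsProposal hash p r v) : u = v :=
  (hE.proposal p hp r hu.2.1 (hE.creation_lt_crash' hu.1 hp hu.2.2.1)).unique hu hv

theorem confirmation_unique {p : V} (hp : p ∉ E.byzantine) {r : ℕ} {u v : HUnit V α}
    (hu : E.IsConfirmation p r u) (hv : E.IsConfirmation p r v) : u = v := by
  obtain ⟨h1, h2, -, x, hx, hc, -⟩ := id hu
  refine (hE.confirmation p hp r h2 ⟨x, hx, ?_⟩).unique hu hv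
  subst h1
  exact hc ▸ hE.creation_lt_crash u hp (hc ▸ lt_of_lt_of_le hx.2.2.1 le_top)

theorem witness_unique {p : V} (hp : p ∉ E.byzantine) {r : ℕ} {u v : HUnit V α}
    (hu : E.IsWitness p r u) (hv : E.IsWitness p r v) : u = v :=
  (hE.witness p hp r (hE.creation_lt_crash' hu.1 hp hu.2.2.1)).unique hu hv

/-- The units of a non-Byzantine validator form a chain, ordered by their creation times. -/
theorem le_of_creation_le {u v : HUnit V α} (hv : v.sender ∉ E.byzantine)
    (hs : u.sender = v.sender) (hvt : E.creation v < ⊤) (h : E.creation u ≤ E.creation v) :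
    Le u v := by
  have hΔ := hE.Δ_pos
  have hu : u.sender ∉ E.byzantine := hs ▸ hv
  have harr : E.arrival v.sender u = E.creation u := hs ▸ hE.arrival_own u hu
  obtain ⟨r, c, hc, h1, h2, hrole⟩ := hE.exists_round hv hvt
  obtain ⟨r', c', hc', h1', h2', hrole'⟩ := hE.exists_round hu (h.trans_lt hvt)
  rw [hs] at hrole'
  have hcc : c' ≤ c := by
    rw [hc, hc'] at h
    exact_mod_cast h
  by_cases hr : r' = r
  · subst hr
    rcases hrole with ⟨hR, rfl⟩ | ⟨hR, hlt⟩ | ⟨hR, rfl⟩ <;>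
      rcases hrole' with ⟨hR', rfl⟩ | ⟨hR', hlt'⟩ | ⟨hR', rfl⟩
    · exact .inl (hE.proposal_unique hv hR' hR)
    · exact absurd hR.2.1 hR'.2.1
    · linarith
    · exact absurd hR'.2.1 hR.2.1
    · exact .inl (hE.confirmation_unique hv hR' hR)
    · linarith
    · right
      rw [hR.2.2.2, received, Set.mem_ofPred_eq, harr, hc']
      exact_mod_cast (by linarith)
    · right
      rw [hR.2.2.2, received, Set.mem_ofPred_eq, harr, hc']
      exact_mod_cast (by linarith)
    · exact .inl (hE.witness_unique hv hR' hR)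
  · -- Units of earlier rounds are created at least `Δ` before the round of `v`.
    right
    have hlt : r' + 1 ≤ r := by
      have : r' ≤ r := hE.start_lt_imp (by linarith)
      omega
    have hstart := hE.start_mono hlt
    rw [start_succ] at hstart
    rcases hrole with ⟨hR, rfl⟩ | ⟨hR, -⟩ | ⟨hR, rfl⟩
    · rw [hR.2.2.2.1, received, Set.mem_ofPred_eq, harr, hc']
      exact_mod_cast (by linarith)
    · obtain ⟨x, -, -, hd⟩ := hR.2.2.2
      rw [hd]
      refine .inl (.inr ⟨hs, ?_⟩)
      rw [hc']
      exact_mod_cast (by linarith)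
    · rw [hR.2.2.2, received, Set.mem_ofPred_eq, harr, hc']
      exact_mod_cast (by linarith)

theorem creation_mono {u v : HUnit V α} (hv : v.sender ∉ E.byzantine)
    (hs : u.sender = v.sender) (h : Le u v) : E.creation u ≤ E.creation v := by
  rw [← hE.arrival_own v hv, ← hE.arrival_own u (hs ▸ hv), hs]
  exact hE.arrival_le_of_le hv h

theorem creation_lt_top_of_arrived {p : V} (hp : p ∉ E.byzantine) {u : HUnit V α}
    (hu : u ∈ E.arrived p) (hs : u.sender ∉ E.byzantine) : E.creation u < ⊤ :=
  (hE.creation_le_arrival p hp u hs).trans_lt hu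

theorem equivocators_arrived_subset {p : V} (hp : p ∉ E.byzantine) :
    equivocators (E.arrived p) ⊆ E.byzantine := by
  rintro q ⟨u, hu, v, hv, rfl, hvs, huv, hvu⟩
  by_contra hq
  rcases le_total (E.creation u) (E.creation v) with h | h
  · exact huv (hE.le_of_creation_le (hvs ▸ hq) hvs.symm
      (hE.creation_lt_top_of_arrived hp hv (hvs ▸ hq)) h)
  · exact hvu (hE.le_of_creation_le hq hvs (hE.creation_lt_top_of_arrived hp hu hq) h)

theorem mem_arrived_of_creation {u : HUnit V α} (hu : u.sender ∉ E.byzantine)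
    (h : E.creation u < ⊤) : u ∈ E.arrived u.sender := by
  rw [arrived, Set.mem_ofPred_eq, hE.arrival_own u hu]
  exact h

theorem state_subset_arrived {p : V} (hp : p ∉ E.byzantine) (s : ℝ) :
    E.state p s ⊆ E.arrived p := by
  have hrec : ∀ s : ℝ, E.received p s ⊆ E.arrived p := received_subset_arrived p
  have hown : ∀ s : ℝ, E.own p s ⊆ E.arrived p := by
    rintro s u ⟨rfl, hu⟩
    exact hE.mem_arrived_of_creation hp (hu.trans_lt (WithTop.coe_lt_top s))
  unfold state
  dsimp only
  split_ifs
  · exact Set.union_subset (hrec _) (hown _)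
  · refine Set.union_subset (Set.union_subset (hrec _) (hown _)) ?_
    rintro v ⟨u, hu, hc, hv⟩
    have hua : u ∈ E.arrived p := hown s ⟨hu.1, hc⟩
    rcases hv with rfl | hv
    exacts [hua, hE.down_subset_arrived hp hua hv]
  · exact fun u hu => lt_of_le_of_lt hu (WithTop.coe_lt_top s)
  · exact Set.union_subset (hrec _) (hown _)

/-- The local DAG contains everything received at least one round ago. -/
theorem received_subset_state {p : V} {s s' : ℝ} (h : s' + 3 * E.Δ ≤ s) :
    E.received p s' ⊆ E.state p s := by
  have hΔ := hE.Δ_pos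
  have hR : 0 < E.roundLength := by unfold roundLength; linarith
  have hlt : s < E.start ⌊s / E.roundLength⌋₊ + 3 * E.Δ := by
    rw [← start_succ, start]
    push_cast
    exact (div_lt_iff₀ hR).1 (Nat.lt_floor_add_one _)
  unfold state
  dsimp only
  split_ifs with h1 h2 h3
  · exact (received_mono (by linarith)).trans Set.subset_union_left
  · exact ((received_mono (by linarith)).trans Set.subset_union_left).trans
      Set.subset_union_left
  · exact fun u hu => le_of_lt (lt_of_lt_of_le (show E.arrival p u < _ from hu)
      (WithTop.coe_le_coe.2 (by linarith)))
  · exact (received_mono (by linarith)).trans Set.subset_union_left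

end IsRun

end Execution

/-! ### Liveness -/

namespace Execution

open HUnit Block

variable {V α κ : Type*} [LinearOrder κ] {hash : Block α → κ} {E : Execution V α}

/-- From round `r` on, all correct validators vote for `B`. -/
def Locked (hash : Block α → κ) (E : Execution V α) (r : ℕ) (B : Block α) : Prop :=
  ∀ u : HUnit V α, E.Correct u.sender → E.creation u < ⊤ →
    (E.start r : WithTop ℝ) ≤ E.creation u → Anc B (vote hash u)

namespace IsRun

variable (hE : E.IsRun hash)
include hE

theorem exists_isWitness {p : V} (hp : E.Correct p) (r : ℕ) : ∃ w, E.IsWitness p r w :=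
  (hE.witness p hp.1 r (hp.2 ▸ WithTop.coe_lt_top _)).exists

theorem witness_mem_received {p q : V} (hp : p ∉ E.byzantine) (hq : q ∉ E.byzantine) {r : ℕ}
    (hr : E.gst ≤ E.start r) {w : HUnit V α} (hw : E.IsWitness q r w) :
    w ∈ E.received p (E.start (r + 1)) := by
  have hΔ := hE.Δ_pos
  refine (hE.arrival_lt p hp w (hw.1 ▸ hq) _ hw.2.2.1 (by linarith)).trans_le ?_
  rw [start_succ]
  exact WithTop.coe_le_coe.2 (by linarith)

/-- Units of later rounds are above everything that was received in the first two thirds of a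
round. The last third has to be excluded, since its units are not in the downset of a
confirmation unit of the next round. -/
theorem received_subset_down {u : HUnit V α} (hu : u.sender ∉ E.byzantine)
    (hc : E.creation u < ⊤) {r : ℕ} (hr : (E.start (r + 1) : WithTop ℝ) ≤ E.creation u) :
    E.received u.sender (E.start r + 2 * E.Δ) ⊆ u.down := by
  have hΔ := hE.Δ_pos
  obtain ⟨ρ, c, hcc, h1, h2, hrole⟩ := hE.exists_round hu hc
  rw [hcc] at hr
  have hr' : E.start (r + 1) ≤ c := WithTop.coe_le_coe.1 hr
  have hρ := hE.start_mono (hE.start_lt_imp (a := r + 1) (b := ρ) (by linarith))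
  rw [start_succ] at hρ
  rcases hrole with ⟨hR, -⟩ | ⟨hR, -⟩ | ⟨hR, -⟩
  · rw [hR.2.2.2.1]
    exact received_mono (by linarith)
  · obtain ⟨x, -, -, hd⟩ := hR.2.2.2
    rw [hd]
    exact ((received_mono (by linarith)).trans Set.subset_union_left).trans Set.subset_union_left
  · rw [hR.2.2.2]
    exact received_mono (by linarith)

section CorrectLeader

variable {r : ℕ} (hr : E.gst ≤ E.start r) {L : V} (hL : E.Correct L) {u : HUnit V α}
  (hu : E.IsProposal hash L (r + 1) u)
include hr hL hu

theorem carried_subset_down {q : V} (hq : E.Correct q) : E.carried q (r + 1) ⊆ u.down := by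
  obtain ⟨w, hw⟩ := hE.exists_isWitness hq r
  have hwL := hE.witness_mem_received hL.1 hq.1 hr hw
  have hs : E.start (r + 1) - E.Δ = E.start r + 2 * E.Δ := by
    rw [start_succ]
    ring
  rw [carried, hs, hu.2.2.2.1]
  rintro v (hv | ⟨hv, hvc⟩)
  · rw [← hw.2.2.2] at hv
    exact hE.mem_received_of_le hL.1 hwL (.inr hv)
  · rw [← hw.2.2.1] at hvc
    exact hE.mem_received_of_le hL.1 hwL (hE.le_of_creation_le (hw.1 ▸ hq.1)
      (hv.trans hw.1.symm) (hw.2.2.1 ▸ WithTop.coe_lt_top _) hvc)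

theorem proposal_arrival {q : V} (hq : q ∉ E.byzantine) :
    (E.start (r + 1) : WithTop ℝ) ≤ E.arrival q u ∧
      E.arrival q u < ((E.start (r + 1) + E.Δ : ℝ) : WithTop ℝ) := by
  have hΔ := hE.Δ_pos
  constructor
  · rw [← hu.2.2.1]
    exact hE.creation_le_arrival q hq u (hu.1 ▸ hL.1)
  · refine hE.arrival_lt q hq u (hu.1 ▸ hL.1) _ hu.2.2.1 ?_
    rw [start_succ]
    linarith

/-- Older units of the leader arrive before the round, as they are below its last witness unit. -/
theorem start_le_creation_of_arrival {q : V} (hq : q ∉ E.byzantine) {y : HUnit V α}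
    (hy : y.sender = L) (hyq : (E.start (r + 1) : WithTop ℝ) ≤ E.arrival q y)
    (hyt : y ∈ E.arrived q) : E.creation u ≤ E.creation y := by
  have hyL : y.sender ∉ E.byzantine := hy ▸ hL.1
  by_contra! hlt
  obtain ⟨w, hw⟩ := hE.exists_isWitness hL r
  obtain ⟨ρ, c, hc, h1, h2, -⟩ :=
    hE.exists_round hyL (hE.creation_lt_top_of_arrived hq hyt hyL)
  rw [hu.2.2.1, hc] at hlt
  have hlt' : c < E.start (r + 1) := WithTop.coe_lt_coe.1 hlt
  rw [start_succ] at hlt'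
  have hρ := hE.start_mono (hE.start_lt_imp (a := ρ) (b := r) (by linarith))
  have hyw : Le y w := hE.le_of_creation_le (hw.1 ▸ hL.1) (hy.trans hw.1.symm)
    (hw.2.2.1 ▸ WithTop.coe_lt_top _) (by
      rw [hc, hw.2.2.1]
      exact WithTop.coe_le_coe.2 (by linarith))
  exact hyq.not_gt (hE.mem_received_of_le hq (hE.witness_mem_received hq hL.1 hr hw) hyw)

theorem isTrigger_proposal {q : V} (hq : q ∉ E.byzantine) : E.IsTrigger q (r + 1) u := by
  obtain ⟨h1, h2⟩ := hE.proposal_arrival hr hL hu hq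
  refine ⟨hu.1.trans hu.2.1.symm, h1, h2, fun y hy hyq => ?_⟩
  rcases eq_or_ne (E.arrival q y) ⊤ with h | h
  · exact h ▸ le_top
  · rw [hu.2.1] at hy
    have hyt : y ∈ E.arrived q := lt_top_iff_ne_top.2 h
    refine hE.arrival_le_of_le hq (hE.le_of_creation_le (hy ▸ hL.1) (hu.1.trans hy.symm)
      (hE.creation_lt_top_of_arrived hq hyt (hy ▸ hL.1)) ?_)
    exact hE.start_le_creation_of_arrival hr hL hu hq hy hyq hyt

theorem eq_of_isTrigger {q : V} (hq : q ∉ E.byzantine) {x : HUnit V α}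
    (hx : E.IsTrigger q (r + 1) x) : x = u := by
  have hΔ := hE.Δ_pos
  obtain ⟨hxs, h1, h2, -⟩ := hx
  rw [hu.2.1] at hxs
  have hxL : x.sender ∉ E.byzantine := hxs ▸ hL.1
  have hxt : x ∈ E.arrived q := h2.trans_le le_top
  have h3 := hE.start_le_creation_of_arrival hr hL hu hq hxs h1 hxt
  have h4 := (hE.creation_le_arrival q hq x hxL).trans_lt h2
  obtain ⟨ρ, c, hc, h5, h6, hrole⟩ :=
    hE.exists_round hxL (hE.creation_lt_top_of_arrived hq hxt hxL)
  rw [hu.2.2.1, hc] at h3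
  rw [hc] at h4
  have h3' : E.start (r + 1) ≤ c := WithTop.coe_le_coe.1 h3
  have h4' : c < E.start (r + 1) + E.Δ := WithTop.coe_lt_coe.1 h4
  obtain rfl : ρ = r + 1 := hE.round_unique h5 h6 h3' (by linarith)
  rw [hxs] at hrole
  rcases hrole with ⟨hR, -⟩ | ⟨hR, -⟩ | ⟨-, rfl⟩
  · exact hE.proposal_unique hL.1 hR hu
  · exact absurd hu.2.1 hR.2.1
  · linarith

/-- Everything that a confirming validator knows besides the proposal was already in the last
witness units, and hence is known to the leader. -/
theorem confirmation_down_eq {q : V} (hq : E.Correct q) {c : HUnit V α}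
    (hc : E.IsConfirmation q (r + 1) c) : c.down = u.downC := by
  obtain ⟨-, -, -, x, hx, -, hd⟩ := hc
  rw [hd, hE.eq_of_isTrigger hr hL hu hq.1 hx]
  exact Set.union_eq_self_of_subset_left
    ((hE.carried_subset_down hr hL hu hq).trans (Set.subset_insert _ _))

theorem anc_vote_confirmation [Finite V] (hinj : Function.Injective hash) {q : V}
    (hq : E.Correct q) {c : HUnit V α} (hc : E.IsConfirmation q (r + 1) c) :
    Anc (vote hash u) (vote hash c) := by
  refine anc_vote_of_down_eq hinj (hE.confirmation_down_eq hr hL hu hq hc) hc.2.2.1 ?_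
  have hua : u ∈ E.arrived L := by
    have := hE.mem_arrived_of_creation (hu.1 ▸ hL.1) (hu.2.2.1 ▸ WithTop.coe_lt_top _)
    rwa [hu.1] at this
  intro h
  rw [hu.1] at h
  exact hL.1 (hE.equivocators_arrived_subset hL.1 (equivocators_mono
    (Set.insert_subset hua (hE.down_subset_arrived hL.1 hua)) h))

/-- In a round with a correct leader every correct validator creates a unit, its proposal or
confirmation, that reaches the other ones within two thirds of the round. -/
theorem exists_early_unit {q : V} (hq : E.Correct q) :
    ∃ z : HUnit V α, z.sender = q ∧ (E.start (r + 1) : WithTop ℝ) ≤ E.creation z ∧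
      ∀ p ∉ E.byzantine, z ∈ E.received p (E.start (r + 1) + 2 * E.Δ) := by
  have hΔ := hE.Δ_pos
  suffices h : ∃ (z : HUnit V α) (c : ℝ), z.sender = q ∧ E.creation z = c ∧
      E.start (r + 1) ≤ c ∧ c < E.start (r + 1) + E.Δ by
    obtain ⟨z, c, hz, hc, h1, h2⟩ := h
    refine ⟨z, hz, hc ▸ WithTop.coe_le_coe.2 h1, fun p hp => ?_⟩
    refine (hE.arrival_lt p hp z (hz ▸ hq.1) c hc ?_).trans (WithTop.coe_lt_coe.2 (by linarith))
    rw [start_succ] at h1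
    linarith
  by_cases hqL : L = q
  · exact ⟨u, _, hu.1.trans hqL, hu.2.2.1, le_rfl, by linarith⟩
  · have htr := hE.isTrigger_proposal hr hL hu hq.1
    obtain ⟨c, hc⟩ := (hE.confirmation q hq.1 (r + 1) (hu.2.1.trans_ne hqL)
      ⟨u, htr, hq.2 ▸ htr.2.2.1.trans_le le_top⟩).exists
    obtain ⟨x, ⟨-, h1, h2, -⟩, hx, -⟩ := hc.2.2.2
    rw [← hx] at h1 h2
    obtain ⟨s, hs⟩ := WithTop.ne_top_iff_exists.1 h2.ne_top
    rw [← hs] at h1 h2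
    exact ⟨c, s, hc.1, hs.symm, WithTop.coe_le_coe.1 h1, WithTop.coe_lt_coe.1 h2⟩

/-- The block proposed by a correct leader after the Global Stabilization Time keeps the votes of
all correct validators for ever. -/
theorem locked_of_proposal [Fintype V] (hinj : Function.Injective hash)
    (hmaj : Fintype.card V < 2 * {p | E.Correct p}.ncard) :
    Locked hash E (r + 1) (vote hash u) := by
  have hΔ := hE.Δ_pos
  intro x
  induction hm : sizeOf x using Nat.strong_induction_on generalizing x with
  | _ m ih =>
  subst hm
  intro hx hxt hxr
  have hxa := hE.mem_arrived_of_creation hx.1 hxt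
  -- Once all early units of the round are below `x`, the correct validators are a majority.
  have hlate : E.received x.sender (E.start (r + 1) + 2 * E.Δ) ⊆ x.down →
      Anc (vote hash u) (vote hash x) := by
    intro hsub
    have hop : {p | E.Correct p} ⊆ {p | Anc (vote hash u) (opinion hash x p)} := by
      intro q hq
      obtain ⟨z, rfl, hzr, hz⟩ := hE.exists_early_unit hr hL hu hq
      obtain ⟨v, hv, hvs, hzv⟩ := exists_latest (hsub (hz _ hx.1)) fun h =>
        hq.1 (hE.equivocators_arrived_subset hx.1
          (equivocators_mono (hE.down_subset_arrived hx.1 hxa) h))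
      have hvb : v.sender ∉ E.byzantine := hvs ▸ hq.1
      rw [Set.mem_ofPred_eq, ← hvs, opinion_eq_vote hv]
      exact ih _ (sizeOf_lt_of_mem_down hv.1) v rfl (hvs ▸ hq)
        (hE.creation_lt_top_of_arrived hx.1 (hE.down_subset_arrived hx.1 hxa hv.1) hvb)
        (hzr.trans (hE.creation_mono hvb hvs.symm hzv))
    refine anc_vote_of_majority hinj ?_
    have h1 := Set.ncard_le_ncard hop (Set.toFinite _)
    have h2 : {p | opinion hash x p ≠ genesis ∧
        ¬ Anc (vote hash u) (opinion hash x p)}.ncard + {p | E.Correct p}.ncard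
          ≤ Fintype.card V := by
      rw [← Set.ncard_union_eq _ (Set.toFinite _) (Set.toFinite _),
        ← Nat.card_eq_fintype_card, ← Set.ncard_univ]
      · exact Set.ncard_le_ncard (Set.subset_univ _) (Set.toFinite _)
      · exact Set.disjoint_left.2 fun p hp hpc => hp.2 (hop hpc)
    omega
  obtain ⟨ρ, c, hc, h1, h2, hrole⟩ := hE.exists_round hx.1 hxt
  rw [hc] at hxr
  have hxr' : E.start (r + 1) ≤ c := WithTop.coe_le_coe.1 hxr
  rcases (hE.start_lt_imp (a := r + 1) (b := ρ) (by linarith)).eq_or_lt with rfl | hlt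
  · rcases hrole with ⟨hR, -⟩ | ⟨hR, -⟩ | ⟨hR, -⟩
    · have hs : x.sender = L := hR.2.1.symm.trans hu.2.1
      rw [hs] at hR
      rw [hE.proposal_unique hL.1 hR hu]
      exact .refl _
    · exact hE.anc_vote_confirmation hr hL hu hinj hx hR
    · exact hlate hR.2.2.2.ge
  · refine hlate (hE.received_subset_down hx.1 hxt ?_)
    rw [hc]
    exact WithTop.coe_le_coe.2 ((hE.start_mono hlt).trans h1)

end CorrectLeader

theorem exists_gst_le_start : ∃ r, E.gst ≤ E.start r := by
  have hΔ := hE.Δ_pos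
  obtain ⟨r, hr⟩ := exists_nat_ge (E.gst / (3 * E.Δ))
  exact ⟨r, (div_le_iff₀ (show 0 < 3 * E.Δ by linarith)).1 hr⟩

/-- Correct leaders keep adding new blocks above the block on which they agree already. -/
theorem exists_locked [Fintype V] (hinj : Function.Injective hash)
    (hmaj : Fintype.card V < 2 * {p | E.Correct p}.ncard)
    (leaders : ∃ᶠ r in atTop, E.Correct (E.leader r)) (h : ℕ) :
    ∃ (r : ℕ) (B : Block α), h ≤ B.height ∧ E.gst ≤ E.start r ∧ Locked hash E r B := by
  have hΔ := hE.Δ_pos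
  obtain ⟨r₀, hr₀⟩ := hE.exists_gst_le_start
  have hnext : ∀ r₁, ∃ r u, r₁ ≤ r ∧ r₀ ≤ r ∧ E.Correct (E.leader (r + 1)) ∧
      E.IsProposal hash (E.leader (r + 1)) (r + 1) u := by
    intro r₁
    obtain ⟨r, hr, hL⟩ := frequently_atTop.1 leaders (max r₁ r₀ + 1)
    obtain ⟨r, rfl⟩ := Nat.exists_eq_add_of_le' (Nat.le_of_add_left_le hr)
    have hr' : max r₁ r₀ ≤ r := by omega
    obtain ⟨u, hu⟩ := (hE.proposal _ hL.1 (r + 1) rfl (hL.2 ▸ WithTop.coe_lt_top _)).exists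
    exact ⟨r, u, (le_max_left _ _).trans hr', (le_max_right _ _).trans hr', hL, hu⟩
  suffices H : ∃ r u, r₀ ≤ r ∧ E.Correct (E.leader (r + 1)) ∧
      E.IsProposal hash (E.leader (r + 1)) (r + 1) u ∧ h ≤ (vote hash u).height by
    obtain ⟨r, u, hr, hL, hu, hh⟩ := H
    have hr' := hr₀.trans (hE.start_mono hr)
    exact ⟨r + 1, _, hh, hr'.trans (hE.start_mono (Nat.le_succ r)),
      hE.locked_of_proposal hr' hL hu hinj hmaj⟩
  induction h with
  | zero =>
    obtain ⟨r, u, -, hr, hL, hu⟩ := hnext 0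
    exact ⟨r, u, hr, hL, hu, Nat.zero_le _⟩
  | succ h ih =>
    obtain ⟨r, u, hr, hL, hu, hh⟩ := ih
    obtain ⟨r', u', hrr, hr', hL', hu'⟩ := hnext (r + 1)
    refine ⟨r', u', hr', hL', hu', ?_⟩
    have hstart := hE.start_mono hrr
    have hgst := hr₀.trans (hE.start_mono hr)
    have hanc : Anc (vote hash u) (vote hash u') := by
      refine hE.locked_of_proposal hgst hL hu hinj hmaj u' (hu'.1 ▸ hL')
        (hu'.2.2.1 ▸ WithTop.coe_lt_top _) ?_
      rw [hu'.2.2.1, start_succ E r']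
      exact WithTop.coe_le_coe.2 (by linarith)
    -- The new block is not among those below `u'`, which include the block of `u`.
    have hmem : u ∈ u'.down := by
      rw [hu'.2.2.2.1]
      refine (hE.proposal_arrival hgst hL hu hL'.1).2.trans (WithTop.coe_lt_coe.2 ?_)
      rw [start_succ E r']
      linarith
    obtain ⟨B, hB, -, hBv⟩ := hu.2.2.2.2
    obtain ⟨B', -, hB', hBv'⟩ := hu'.2.2.2.2
    by_contra! hlt
    refine hB' (.inr ⟨u, hmem, ?_⟩)
    rw [hB, ← hBv, ← hBv', hanc.eq_of_height_le (by omega)]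

/-- If the correct validators are enough for a quorum, then a block for which they all vote is
finalized eventually. The levels of the summit consist of their units from every other round on,
up to a round from which on they are in the local DAG. -/
theorem eventually_finalized_of_locked [Fintype V] {t : ℕ}
    (hq : Fintype.card V + t < 2 * {p | E.Correct p}.ncard) {r : ℕ} (hr : E.gst ≤ E.start r)
    {B : Block α} (hB : Locked hash E r B) {p : V} (hp : E.Correct p) :
    ∀ᶠ s : ℝ in atTop, E.Finalized hash t p s B := by
  have hΔ := hE.Δ_pos
  set k := t + 1 with hk
  filter_upwards [eventually_ge_atTop (E.start (r + 2 * k + 1) + 3 * E.Δ)] with s hs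
  have hstart : ∀ {a b : ℕ}, a ≤ b → (E.start a : WithTop ℝ) ≤ E.start b := fun h =>
    WithTop.coe_le_coe.2 (hE.start_mono h)
  have hgst : ∀ i, E.gst ≤ E.start (r + i) := fun i => hr.trans (hE.start_mono (by omega))
  set C : ℕ → Set (HUnit V α) := fun i => {u | E.Correct u.sender ∧
    (E.start (r + 2 * i) : WithTop ℝ) ≤ E.creation u ∧
    u ∈ E.received p (E.start (r + 2 * k + 1))} with hC
  have hCt : ∀ {i} {u : HUnit V α}, u ∈ C i → E.creation u < ⊤ := fun hu =>
    hE.creation_lt_top_of_arrived hp.1 (received_subset_arrived p _ hu.2.2) hu.1.1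
  have hwit : ∀ i ≤ k, ∀ {q w}, E.Correct q → E.IsWitness q (r + 2 * i) w → w ∈ C i := by
    intro i hi q w hq hw
    refine ⟨hw.1 ▸ hq, ?_, received_mono (hE.start_mono (by omega))
      (hE.witness_mem_received hp.1 hq.1 (hgst _) hw)⟩
    rw [hw.2.2.1]
    exact WithTop.coe_le_coe.2 (by linarith)
  have hstate := hE.received_subset_state (p := p) hs
  refine ⟨{p | E.Correct p}.ncard, k, C, ⟨?_, ?_, ?_, ?_, ?_, ?_, ?_⟩, ?_⟩
  · exact fun u hu => hstate hu.2.2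
  · exact fun i _ u hu => ⟨hu.1, (hstart (by omega)).trans hu.2.1, hu.2.2⟩
  · obtain ⟨w, hw⟩ := hE.exists_isWitness hp (r + 2 * k)
    exact ⟨w, hwit k le_rfl hp hw⟩
  · exact fun u hu => hB u hu.1 (hCt hu) hu.2.1
  · exact fun u hu h => hu.1.1 (hE.equivocators_arrived_subset hp.1
      (equivocators_mono (hE.state_subset_arrived hp.1 s) h))
  · intro i _ u₀ h₀ u₂ h₂ u₁ h01 h12 hs01 hs12
    have h1 : E.Correct u₁.sender := hs01 ▸ h₀.1
    exact ⟨h1, h₀.2.1.trans (hE.creation_mono h1.1 hs01 h01),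
      hE.mem_received_of_le hp.1 h₂.2.2 h12⟩
  · intro i hi u hu
    refine Set.ncard_le_ncard (fun q hq => ?_) (Set.toFinite _)
    obtain ⟨v, hv⟩ := hE.exists_isWitness hq (r + 2 * i)
    obtain ⟨w, hw⟩ := hE.exists_isWitness hq (r + 2 * (i + 1))
    refine ⟨v, ⟨.inr ?_, hwit i hi.le hq hv, w, hwit (i + 1) hi hq hw,
      hv.1.trans hw.1.symm⟩, hv.1⟩
    refine hE.received_subset_down hu.1.1 (hCt hu) (r := r + 2 * i + 1) hu.2.1
      (received_mono (by linarith) (hE.witness_mem_received hu.1.1 hq.1 (hgst _) hv))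
  · have h1 : (t : ℝ) + 1 ≤ 2 * ({p | E.Correct p}.ncard : ℝ) - Fintype.card V := by
      have : (Fintype.card V : ℝ) + t + 1 ≤ 2 * ({p | E.Correct p}.ncard : ℝ) := by
        exact_mod_cast hq
      linarith
    have h2 : ((t : ℝ) + 1) < 2 ^ k := by
      have := Nat.lt_two_pow_self (n := k)
      rw [hk] at this ⊢
      exact_mod_cast this
    have h3 : ((2 : ℝ) ^ k)⁻¹ * (t + 1) < 1 := by
      rw [inv_mul_lt_iff₀ (by positivity)]
      linarith
    have h4 : ((2 : ℝ) ^ k)⁻¹ ≤ 1 := inv_le_one_of_one_le₀ (one_le_pow₀ (by norm_num))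
    calc (t : ℝ) < (t + 1) * (1 - ((2 : ℝ) ^ k)⁻¹) := by linarith
      _ ≤ _ := mul_le_mul_of_nonneg_right h1 (by linarith)

end IsRun

theorem card_le_ncard_correct [Fintype V] (E : Execution V α) :
    Fintype.card V ≤ {p | E.Correct p}.ncard + E.byzantine.ncard + E.crashing.ncard := by
  rw [← Nat.card_eq_fintype_card, ← Set.ncard_univ]
  refine (Set.ncard_le_ncard (t := {p | E.Correct p} ∪ E.byzantine ∪ E.crashing) ?_
    (Set.toFinite _)).trans <| (Set.ncard_union_le _ _).trans <|
      Nat.add_le_add_right (Set.ncard_union_le _ _) _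
  intro p _
  by_cases h1 : p ∈ E.byzantine
  · exact .inl (.inr h1)
  · by_cases h2 : E.crash p = ⊤
    · exact .inl (.inl ⟨h1, h2⟩)
    · exact .inr ⟨h1, h2⟩

end Execution

end Highway

open Highway Highway.Block in
theorem theorem2 {V α κ : Type*} [Fintype V] [LinearOrder κ]
    (hash : Highway.Block α → κ) (hash_injective : Function.Injective hash)
    (E : Highway.Execution V α) (hE : E.IsRun hash)
    (leaders : ∃ᶠ r in atTop, E.Correct (E.leader r))
    (t : ℕ) (ht : (t : ℝ) < (Fintype.card V : ℝ) / 3)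
    (hf : E.byzantine.ncard ≤ t)
    (hc : (E.crashing.ncard : ℝ) < ((Fintype.card V : ℝ) - 3 * (t : ℝ)) / 2) :
    ∀ p : V, E.Correct p →
      ∃ b : ℕ → Highway.Block α,
        b 0 = Highway.Block.genesis ∧
        (∀ h, Highway.Block.IsChild (b h) (b (h + 1))) ∧
        (∀ s : ℝ, 0 ≤ s → ∀ B, E.Finalized hash t p s B → ∃ h, B = b h) ∧
        ∀ h, ∀ᶠ s : ℝ in atTop, E.Finalized hash t p s (b h) := by
  intro p hp
  have hq : Fintype.card V + t < 2 * {p | E.Correct p}.ncard := by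
    have h1 := E.card_le_ncard_correct
    have h2 : 2 * E.crashing.ncard + 3 * t < Fintype.card V := by
      have : 2 * (E.crashing.ncard : ℝ) + 3 * t < Fintype.card V := by linarith
      exact_mod_cast this
    omega
  have hcomp : ∀ {s s' : ℝ} {B B' : Highway.Block α}, E.Finalized hash t p s B →
      E.Finalized hash t p s' B' → Anc B B' ∨ Anc B' B := fun h h' =>
    Final.comparable hash_injective h h' (hE.state_subset_arrived hp.1 _)
      (hE.state_subset_arrived hp.1 _) (fun _ hu => hE.down_subset_arrived hp.1 hu)
      ((Set.ncard_le_ncard (hE.equivocators_arrived_subset hp.1) (Set.toFinite _)).trans hf)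
  have hex : ∀ h : ℕ, ∃ B : Highway.Block α, B.height = h ∧
      ∀ᶠ s : ℝ in atTop, E.Finalized hash t p s B := by
    intro h
    obtain ⟨r, B, hB, hr, hlock⟩ := hE.exists_locked hash_injective (by omega) leaders h
    obtain ⟨A, hA, hAh⟩ := exists_anc_height_eq B hB
    exact ⟨A, hAh, (hE.eventually_finalized_of_locked hq hr hlock hp).mono
      fun s hs => Final.of_anc hA hs⟩
  choose b hbh hb using hex
  refine ⟨b, height_eq_zero_iff.1 (hbh 0), fun h => ?_, fun s _ B hB => ⟨B.height, ?_⟩, hb⟩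
  · obtain ⟨s, hs⟩ := (hb (h + 1)).exists
    obtain ⟨s', hs'⟩ := (hb h).exists
    have hanc : Anc (b h) (b (h + 1)) := by
      rcases hcomp hs' hs with h' | h'
      · exact h'
      · have := h'.height_le
        rw [hbh, hbh] at this
        omega
    exact hanc.isChild (by rw [hbh, hbh])
  · obtain ⟨s', hs'⟩ := (hb B.height).exists
    rcases hcomp hB hs' with h' | h'
    · exact h'.eq_of_height_le (hbh _).le
    · exact (h'.eq_of_height_le (hbh _).ge).symm
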